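/- Let $n\ge 2$, let $S^{n-1}=\{x\in\mathbb R^n:|x|=1\}$, and let $\sigma_{n-1}$ be the uniform probability measure on $S^{n-1}$. For a $C^1$ function $f:S^{n-1}\to\mathbb R$ and $x\in S^{n-1}$, let the spherical gradient $\nabla_S f(x)$ be the shortest vector $w\in\mathbb R^n$ such that $$f(x')=f(x)+\langle w,x'-x\rangle+o(|x'-x|),\qquad x'\to x,\ x'\in S^{n-1}.$$ For $-1\le\alpha\le 1$ put $$\psi_n(\alpha)=\frac{1}{2^{n-2}\,\Gamma(n/2)^2}\int_0^1 (1-t^2)^{\frac{n-2}{2}}\left[\int_0^\infty\!\!\int_0^\infty \exp\left(-\frac{r^2+r'^2-2rr't\alpha}{2}\right)(rr')^{n-2}\,dr\,dr'\right]dt\in(0,\infty].$$ Let $\nu_n$ be the positive measure on $S^{n-1}\times S^{n-1}$ with density $\psi_n(\langle x,y\rangle)$ with respect to $\sigma_{n-1}\otimes\sigma_{n-1}$, let $c_n=\nu_n(S^{n-1}\times S^{n-1})$ be its total mass (which is positive and finite), and let $\mu_n=c_n^{-1}\nu_n$. Then for every $C^1$ function $f:S^{n-1}\to\mathbb R$ with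 $\int_{S^{n-1}} f\,d\sigma_{n-1}=0$, $$\int_{S^{n-1}} e^{f}\,d\sigma_{n-1}\le\int_{S^{n-1}}\int_{S^{n-1}}\exp\bigl\{c_n\langle\nabla_S f(x),\nabla_S f(y)\rangle\bigr\}\,d\mu_n(x,y).$$ In particular, $$\int_{S^{n-1}} e^{f}\,d\sigma_{n-1}\le\int_{S^{n-1}} e^{c_n|\nabla_S f|^2}\,d\sigma_{n-1}.$$ -/

import Mathlib

open Real Set Filter Topology MeasureTheory Metric
open scoped ENNReal Manifold ContDiff RealInnerProductSpace

noncomputable section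

namespace SphereCov

/-- The space `ℝⁿ` with its Euclidean norm. -/
abbrev E (n : ℕ) : Type := EuclideanSpace ℝ (Fin n)

/-- The unit sphere `{x ∈ ℝⁿ : |x| = 1}`. -/
abbrev S (n : ℕ) : Type := sphere (0 : E n) 1

/-- The uniform distribution on the unit sphere of `ℝⁿ`: the surface measure induced by
Lebesgue measure, divided by its total mass. -/
def sigma (n : ℕ) : Measure (S n) :=
  ((volume : Measure (E n)).toSphere univ)⁻¹ • (volume : Measure (E n)).toSphere

/-- The vector `w ∈ ℝⁿ` satisfies the first-order Taylor expansion of `f` at the point `x` of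
the sphere: `f x' = f x + ⟨w, x' - x⟩ + o(|x' - x|)` as `x' → x` along the sphere. -/
def HasSphereTaylor {n : ℕ} (f : S n → ℝ) (x : S n) (w : E n) : Prop :=
  (fun x' : S n => f x' - f x - ⟪w, (x' : E n) - (x : E n)⟫)
    =o[𝓝 x] (fun x' : S n => (x' : E n) - (x : E n))

/-- `w` is the spherical gradient of `f` at `x`: a shortest vector of `ℝⁿ` satisfying the
first-order Taylor expansion of `f` at `x` along the sphere. -/
def IsSphereGradient {n : ℕ} (f : S n → ℝ) (x : S n) (w : E n) : Prop :=
  HasSphereTaylor f x w ∧ ∀ w' : E n, HasSphereTaylor f x w' → ‖w‖ ≤ ‖w'‖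

/-- There is at most one shortest vector, so "the" spherical gradient is well defined. -/
theorem IsSphereGradient.unique {n : ℕ} {f : S n → ℝ} {x : S n} {v w : E n}
    (hv : IsSphereGradient f x v) (hw : IsSphereGradient f x w) : v = w := by
  have hm : HasSphereTaylor f x ((2⁻¹ : ℝ) • (v + w)) := by
    have h := (hv.1.add hw.1).const_mul_left (2⁻¹ : ℝ)
    refine h.congr_left fun x' => ?_
    rw [inner_smul_left, inner_add_left]
    simp only [conj_trivial]
    ring
  have h1 := hv.2 _ hw.1
  have h2 := hw.2 _ hv.1
  have h3 := hv.2 _ hm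
  rw [norm_smul, Real.norm_of_nonneg (by norm_num)] at h3
  have h4 := parallelogram_law_with_norm ℝ v w
  have h5 : ‖v - w‖ * ‖v - w‖ ≤ 0 := by
    nlinarith [norm_nonneg v, norm_nonneg w, norm_nonneg (v + w)]
  have h6 : ‖v - w‖ = 0 := by nlinarith [norm_nonneg (v - w)]
  exact sub_eq_zero.mp (norm_eq_zero.mp h6)

open Classical in
/-- The spherical gradient `∇_S f (x)`, a vector of `ℝⁿ` (and `0` by convention where `f` has no
first-order Taylor expansion along the sphere). -/
def sphereGradient {n : ℕ} (f : S n → ℝ) (x : S n) : E n :=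
  if h : ∃ w, IsSphereGradient f x w then h.choose else 0

/-- The function `ψ_n` on `[-1, 1]`, with values in `[0, ∞]`. It is used for `n ≥ 2`, so that the
subtractions of natural numbers are the true ones. -/
def psi (n : ℕ) (α : ℝ) : ℝ≥0∞ :=
  ENNReal.ofReal (1 / (2 ^ (n - 2) * Real.Gamma ((n : ℝ) / 2) ^ 2)) *
    ∫⁻ t in Ioo (0 : ℝ) 1, ENNReal.ofReal (√(1 - t ^ 2) ^ (n - 2)) *
      ∫⁻ r in Ioi (0 : ℝ), ∫⁻ r' in Ioi (0 : ℝ),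
        ENNReal.ofReal (Real.exp (-((r ^ 2 + r' ^ 2 - 2 * r * r' * t * α) / 2)) *
          (r * r') ^ (n - 2))

/-- The positive measure `ν_n` on pairs of points of the sphere, of density `ψ_n(⟨x, y⟩)` with
respect to the product of the uniform distributions. -/
def nu (n : ℕ) : Measure (S n × S n) :=
  ((sigma n).prod (sigma n)).withDensity fun p => psi n ⟪(p.1 : E n), (p.2 : E n)⟫

/-- The total mass `c_n` of `ν_n`. -/
def c (n : ℕ) : ℝ := (nu n).real univ

/-- The normalized measure `μ_n`, for which `ν_n = c_n μ_n`. -/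
def mu (n : ℕ) : Measure (S n × S n) := (nu n univ)⁻¹ • nu n

end SphereCov

end

noncomputable section

namespace SphereCov

/-! The heart of the proof is a covariance identity on the sphere (`sphere_covariance`): Cov_σ(f, g)
= ∫ ⟨∇_S f(x), ∇_S g(y)⟩ dν_n(x, y). It is inherited from Gaussian space.

For independent standard Gaussian vectors X, Y put Z_θ = cos θ X + sin θ Y, which rotates X into Y.
Differentiating G(Z_θ) in θ and integrating by parts gives E F(X)(G(X) - G(Y)) = ∫_0^{π/2} sin θ
E⟨∇F(X), ∇G(Z_θ)⟩ dθ (`gaussian_covariance`), and the left side is Cov(F(X), G(X)).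

Now let F, G be the extensions of f, g that are constant on rays. The direction of X is uniform, so
the left side is the spherical covariance. Since ∇F(x) = |x|⁻¹ ∇_S f(x/|x|), the right side involves
only the directions of X and Z_θ, under the weight sin θ / (|X| |Z_θ|). In polar coordinates, with t
= cos θ, the weighted law of these directions has exactly the density ψ_n (`lintegral_arcMeasure`).
The gradients blow up at the origin, but integrably because n ≥ 2, and a damping factor removes the
singularity (`gaussian_covariance_of_singular`).

With g = e^f and f of mean zero the identity reads ∫ f e^f dσ = c_n ∫ ⟨∇_S f(x), ∇_S f(y)⟩ e^{f(y)}
dμ_n (`integral_mul_exp_eq`). Both marginals of μ_n are uniform, by rotation invariance and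
symmetry, so the left side is also the μ_n-integral of f(y) e^{f(y)}. The variational formula for
entropy then compares the integrals of the exponentials (`integral_exp_le_of_integral_mul_exp_le`).
The second inequality follows from 2⟨a, b⟩ ≤ |a|² + |b|², the arithmetic-geometric mean inequality
and the marginals. -/

/-! ### Polar coordinates and the direction of a Gaussian vector. -/

theorem lintegral_polar {n : ℕ} {H : E n → ℝ≥0∞} (hn : 1 ≤ n) (hH : Measurable H) :
    ∫⁻ x, H x = ∫⁻ ξ : S n, ∫⁻ r in Ioi (0 : ℝ), ENNReal.ofReal (r ^ (n - 1)) * H (r • (ξ : E n))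
      ∂(volume : Measure ℝ) ∂(volume : Measure (E n)).toSphere := by
  have : NeZero n := ⟨by omega⟩
  have h1 := (volume : Measure (E n)).measurePreserving_homeomorphUnitSphereProd
  have h2 := h1.lintegral_comp_emb (Homeomorph.measurableEmbedding _)
    (fun p => H ((p.2 : ℝ) • (p.1 : E n)))
  rw [← lintegral_add_compl H (measurableSet_singleton (0 : E n))]
  rw [Measure.restrict_singleton, measure_singleton, zero_smul, lintegral_zero_measure, zero_add,
    ← lintegral_subtype_comap (measurableSet_singleton (0 : E n)).compl]
  have h3 : ∀ x : ({0}ᶜ : Set (E n)), H x = H (((homeomorphUnitSphereProd (E n) x).2 : ℝ) •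
      ((homeomorphUnitSphereProd (E n) x).1 : E n)) := by
    rintro ⟨x, hx⟩
    have : ‖x‖ ≠ 0 := norm_ne_zero_iff.2 hx
    simp [smul_smul, this]
  rw [lintegral_congr h3, h2, lintegral_prod _ (by fun_prop)]
  refine lintegral_congr fun ξ => ?_
  rw [Measure.volumeIoiPow, lintegral_withDensity_eq_lintegral_mul _ (by fun_prop) (by fun_prop)]
  simp only [Pi.mul_apply, finrank_euclideanSpace, Fintype.card_fin]
  rw [lintegral_subtype_comap measurableSet_Ioi
    (fun r : ℝ => ENNReal.ofReal (r ^ (n - 1)) * H (r • (ξ : E n)))]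

/-- The radial projection onto the sphere, extended by `e` at the origin. -/
def radial {n : ℕ} (e : S n) (x : E n) : S n :=
  ⟨if x = 0 then e else ‖x‖⁻¹ • x, by
    split_ifs with h
    · exact e.2
    · have : ‖x‖ ≠ 0 := norm_ne_zero_iff.2 h
      simp [norm_smul, this]⟩

theorem coe_radial {n : ℕ} (e : S n) {x : E n} (hx : x ≠ 0) :
    (radial e x : E n) = ‖x‖⁻¹ • x := by simp [radial, hx]

@[fun_prop]
theorem measurable_radial {n : ℕ} (e : S n) : Measurable (radial e) := by
  refine Measurable.subtype_mk ?_
  exact Measurable.ite (measurableSet_singleton 0) measurable_const (by fun_prop)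

theorem norm_coe {n : ℕ} (ξ : S n) : ‖(ξ : E n)‖ = 1 := by simp

theorem coe_ne_zero {n : ℕ} (ξ : S n) : (ξ : E n) ≠ 0 := by
  intro h; simpa [h] using norm_coe ξ

theorem radial_smul {n : ℕ} (e : S n) {r : ℝ} (hr : 0 < r) (x : E n) :
    radial e (r • x) = radial e x := by
  rcases eq_or_ne x 0 with rfl | hx
  · rw [smul_zero]
  ext1
  rw [coe_radial e (smul_ne_zero hr.ne' hx), coe_radial e hx, norm_smul, smul_smul,
    Real.norm_of_nonneg hr.le]
  congr 1
  field_simp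

theorem radial_coe {n : ℕ} (e ξ : S n) : radial e ξ = ξ := by
  ext1; simp [coe_radial e (coe_ne_zero ξ)]

theorem radial_smul_coe {n : ℕ} (e : S n) {r : ℝ} (hr : 0 < r) (ξ : S n) :
    radial e (r • (ξ : E n)) = ξ := by
  rw [radial_smul e hr, radial_coe]

theorem toSphere_univ {n : ℕ} (hn : 1 ≤ n) :
    (volume : Measure (E n)).toSphere univ =
      ENNReal.ofReal (2 * π ^ ((n : ℝ) / 2) / Real.Gamma ((n : ℝ) / 2)) := by
  have : NeZero n := ⟨by omega⟩
  have hn' : (0 : ℝ) < n := by exact_mod_cast hn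
  have hG := Real.Gamma_pos_of_pos (half_pos hn')
  rw [Measure.toSphere_apply_univ, EuclideanSpace.volume_ball, finrank_euclideanSpace,
    Fintype.card_fin, ENNReal.ofReal_one, one_pow, one_mul, ← ENNReal.ofReal_natCast,
    ← ENNReal.ofReal_mul hn'.le, Real.Gamma_add_one (by positivity), Real.sqrt_eq_rpow,
    ← Real.rpow_natCast, ← Real.rpow_mul Real.pi_pos.le, one_div_mul_eq_div]
  congr 1
  field_simp

theorem toSphere_univ_ne_zero {n : ℕ} (hn : 1 ≤ n) :
    (volume : Measure (E n)).toSphere univ ≠ 0 := by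
  have : NeZero n := ⟨by omega⟩
  simp [(measure_ball_pos _ _ _).ne', NeZero.ne n]

theorem toSphere_eq_smul_sigma {n : ℕ} (hn : 1 ≤ n) :
    (volume : Measure (E n)).toSphere = (volume : Measure (E n)).toSphere univ • sigma n := by
  rw [sigma, smul_smul, ENNReal.mul_inv_cancel (toSphere_univ_ne_zero hn) (measure_ne_top _ _),
    one_smul]

theorem isProbabilityMeasure_sigma {n : ℕ} (hn : 1 ≤ n) : IsProbabilityMeasure (sigma n) :=
  ⟨by simp only [sigma, Measure.smul_apply, smul_eq_mul]
      exact ENNReal.inv_mul_cancel (toSphere_univ_ne_zero hn) (measure_ne_top _ _)⟩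

theorem integral_gaussian (n : ℕ) :
    ∫ x : E n, rexp (-(‖x‖ ^ 2 / 2)) = (2 * π) ^ ((n : ℝ) / 2) := by
  have := GaussianFourier.integral_rexp_neg_mul_sq_norm (V := E n) (b := 1 / 2) (by norm_num)
  rw [finrank_euclideanSpace, Fintype.card_fin] at this
  convert this using 2
  · ext x; congr 1; ring
  · ring_nf

theorem integrable_gaussian (n : ℕ) : Integrable fun x : E n => rexp (-(‖x‖ ^ 2 / 2)) := by
  refine .of_integral_ne_zero ?_
  rw [integral_gaussian]
  positivity

theorem lintegral_gaussian (n : ℕ) :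
    ∫⁻ x : E n, ENNReal.ofReal (rexp (-(‖x‖ ^ 2 / 2))) =
      ENNReal.ofReal ((2 * π) ^ ((n : ℝ) / 2)) := by
  rw [← integral_gaussian, ofReal_integral_eq_lintegral_ofReal (integrable_gaussian n)
    (.of_forall fun x => (exp_pos _).le)]

/-- The direction of a standard Gaussian vector is uniformly distributed. -/
theorem lintegral_gaussian_radial {n : ℕ} (hn : 1 ≤ n) (e : S n) {h : S n → ℝ≥0∞}
    (hh : Measurable h) :
    ∫⁻ x : E n, ENNReal.ofReal (rexp (-(‖x‖ ^ 2 / 2))) * h (radial e x) =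
      ENNReal.ofReal ((2 * π) ^ ((n : ℝ) / 2)) * ∫⁻ ξ, h ξ ∂sigma n := by
  have key : ∀ h : S n → ℝ≥0∞, Measurable h →
      ∫⁻ x : E n, ENNReal.ofReal (rexp (-(‖x‖ ^ 2 / 2))) * h (radial e x) =
      ((∫⁻ r in Ioi (0 : ℝ), ENNReal.ofReal (r ^ (n - 1)) *
        ENNReal.ofReal (rexp (-(r ^ 2 / 2)))) * (volume : Measure (E n)).toSphere univ) *
        ∫⁻ ξ, h ξ ∂sigma n := by
    intro h hh
    rw [lintegral_polar hn (by fun_prop), mul_assoc,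
      ← smul_eq_mul ((volume : Measure (E n)).toSphere univ),
      ← lintegral_smul_measure, ← toSphere_eq_smul_sigma hn, ← lintegral_const_mul _ hh]
    refine lintegral_congr fun ξ => ?_
    rw [← lintegral_mul_const _ (by fun_prop)]
    refine setLIntegral_congr_fun measurableSet_Ioi fun r hr => ?_
    rw [radial_smul_coe e hr, norm_smul, norm_coe, mul_one, Real.norm_of_nonneg (le_of_lt hr),
      mul_assoc]
  -- The constant function 1 calibrates the radial constant, which therefore need not be computed.
  have h1 := key (fun _ => 1) measurable_const
  have := isProbabilityMeasure_sigma hn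
  simp only [mul_one, lintegral_const, measure_univ, lintegral_gaussian] at h1
  rw [key h hh, ← h1]

/-! ### Gaussian covariance by rotating a pair of independent vectors. -/

/-- The unnormalized density of a pair of independent standard Gaussian vectors. -/
def gauss2 {n : ℕ} (p : E n × E n) : ℝ := rexp (-((‖p.1‖ ^ 2 + ‖p.2‖ ^ 2) / 2))

theorem gauss2_eq_mul {n : ℕ} (p : E n × E n) :
    gauss2 p = rexp (-(‖p.1‖ ^ 2 / 2)) * rexp (-(‖p.2‖ ^ 2 / 2)) := by
  rw [gauss2, ← Real.exp_add]; congr 1; ring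

theorem gauss2_pos {n : ℕ} (p : E n × E n) : 0 < gauss2 p := exp_pos _

@[fun_prop]
theorem continuous_gauss2 {n : ℕ} : Continuous (gauss2 (n := n)) := by
  unfold gauss2; fun_prop

@[fun_prop]
theorem measurable_gauss2 {n : ℕ} : Measurable (gauss2 (n := n)) := continuous_gauss2.measurable

theorem integrable_norm_mul_gaussian (n : ℕ) :
    Integrable fun x : E n => ‖x‖ * rexp (-(‖x‖ ^ 2 / 2)) := by
  have h : Integrable fun x : E n => rexp (-(1 / 4) * ‖x‖ ^ 2) := by
    refine .of_integral_ne_zero ?_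
    rw [GaussianFourier.integral_rexp_neg_mul_sq_norm (by norm_num)]
    positivity
  refine h.mono' (by fun_prop) (.of_forall fun x => ?_)
  rw [Real.norm_of_nonneg (by positivity)]
  have h1 : ‖x‖ ≤ rexp (‖x‖ ^ 2 / 4) := by
    nlinarith [Real.add_one_le_exp (‖x‖ ^ 2 / 4), sq_nonneg (‖x‖ - 2)]
  calc _ ≤ rexp (‖x‖ ^ 2 / 4) * rexp (-(‖x‖ ^ 2 / 2)) := by gcongr
    _ = _ := by rw [← Real.exp_add]; congr 1; ring

theorem integrable_gauss2_dominant (n : ℕ) :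
    Integrable fun p : E n × E n => (1 + ‖p.1‖ + ‖p.2‖) * gauss2 p := by
  have h1 := (integrable_gaussian n).mul_prod (integrable_gaussian n)
  have h2 := (integrable_norm_mul_gaussian n).mul_prod (integrable_gaussian n)
  have h3 := (integrable_gaussian n).mul_prod (integrable_norm_mul_gaussian n)
  refine ((h1.add h2).add h3).congr (.of_forall fun p => ?_)
  simp only [Pi.add_apply, gauss2_eq_mul]
  ring

theorem integrable_mul_gauss2 {n : ℕ} {f : E n × E n → ℝ} {C : ℝ} (hf : Measurable f)
    (h : ∀ p, |f p| ≤ C * (1 + ‖p.1‖ + ‖p.2‖)) : Integrable fun p => f p * gauss2 p := by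
  refine ((integrable_gauss2_dominant n).const_mul C).mono' (by fun_prop) (.of_forall fun p => ?_)
  rw [norm_mul, Real.norm_eq_abs, Real.norm_of_nonneg (gauss2_pos p).le, ← mul_assoc]
  exact mul_le_mul_of_nonneg_right (h p) (gauss2_pos p).le

/-- The direction (s eᵢ, -c eᵢ) is chosen because c x + s y is constant along it. -/
theorem hasLineDerivAt_gauss2 {n : ℕ} (c s : ℝ) (i : Fin n) (p : E n × E n) :
    HasLineDerivAt ℝ gauss2 ((c * p.2 i - s * p.1 i) * gauss2 p) p
      (s • EuclideanSpace.single i 1, (-c) • EuclideanSpace.single i 1) := by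
  have h1 : HasFDerivAt (fun p : E n × E n => -(2⁻¹ : ℝ) * (‖p.1‖ ^ 2 + ‖p.2‖ ^ 2)) _ p :=
    ((hasFDerivAt_fst (p := p) (𝕜 := ℝ)).norm_sq.add
      ((hasFDerivAt_snd (p := p) (𝕜 := ℝ)).norm_sq)).const_mul (-(2⁻¹ : ℝ))
  have e : (gauss2 : E n × E n → ℝ) = fun p => rexp (-(2⁻¹ : ℝ) * (‖p.1‖ ^ 2 + ‖p.2‖ ^ 2)) := by
    ext p; rw [gauss2]; congr 1; ring
  have h2 := h1.exp.hasLineDerivAt (s • EuclideanSpace.single i 1, (-c) • EuclideanSpace.single i 1)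
  rw [e]
  convert! h2 using 1
  simp [inner_smul_right, EuclideanSpace.inner_single_right]
  ring

/-- Integration by parts along a direction that fixes c x + s y. The factor with `H` behaves as a
constant, so `H` need only be bounded and measurable; only `F` and the Gaussian density are
differentiated, and `F` contributes the factor `s`. -/
theorem integral_coord_mul_gauss2 {n : ℕ} {F : E n → ℝ} {F' H : E n → E n} {B : ℝ}
    (hF : ∀ x, HasGradientAt F (F' x) x) (hF' : Measurable F') (hH : Measurable H)
    (hFB : ∀ x, |F x| ≤ B) (hFB' : ∀ x, ‖F' x‖ ≤ B) (hHB : ∀ x, ‖H x‖ ≤ B) (c s : ℝ) (i : Fin n) :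
    ∫ p : E n × E n, F p.1 * (H (c • p.1 + s • p.2) i * (c * p.2 i - s * p.1 i)) * gauss2 p =
      -(s * ∫ p : E n × E n, F' p.1 i * H (c • p.1 + s • p.2) i * gauss2 p) := by
  have hFc : Continuous F := continuous_iff_continuousAt.2 fun x => (hF x).continuousAt
  have hFm := hFc.measurable
  have hB : 0 ≤ B := (abs_nonneg _).trans (hFB 0)
  have hcoord : ∀ (x : E n), |x i| ≤ ‖x‖ := fun x => PiLp.norm_apply_le x i
  have hHi : ∀ x, |H x i| ≤ B := fun x => (hcoord _).trans (hHB x)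
  have hFi : ∀ x, |F' x i| ≤ B := fun x => (hcoord _).trans (hFB' x)
  have : (volume : Measure (E n × E n)).IsAddHaarMeasure := by
    rw [Measure.volume_eq_prod]; infer_instance
  have key := integral_bilinear_hasLineDerivAt_right_eq_neg_left_of_integrable
    (μ := (volume : Measure (E n × E n))) (B := ContinuousLinearMap.mul ℝ ℝ)
    (f := fun p => F p.1 * H (c • p.1 + s • p.2) i)
    (f' := fun p => s * (F' p.1 i * H (c • p.1 + s • p.2) i))
    (g := gauss2) (g' := fun p => (c * p.2 i - s * p.1 i) * gauss2 p)
    (v := (s • EuclideanSpace.single i 1, (-c) • EuclideanSpace.single i 1))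
    ?_ ?_ ?_ ?_ (fun p _ => hasLineDerivAt_gauss2 c s i p)
  · simp only [ContinuousLinearMap.mul_apply'] at key
    rw [← integral_const_mul]
    refine (integral_congr_ae (.of_forall fun p => ?_)).trans
      (key.trans (congrArg Neg.neg (integral_congr_ae (.of_forall fun p => ?_)))) <;>
    · simp only
      ring
  · simp only [ContinuousLinearMap.mul_apply']
    refine integrable_mul_gauss2 (C := |s| * (B * B)) (by fun_prop) fun p => ?_
    rw [abs_mul, abs_mul]
    calc _ ≤ |s| * (B * B) * 1 := by rw [mul_one]; gcongr; exacts [hFi _, hHi _]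
      _ ≤ _ := by gcongr; linarith [norm_nonneg p.1, norm_nonneg p.2]
  · simp only [ContinuousLinearMap.mul_apply', ← mul_assoc]
    refine integrable_mul_gauss2 (C := (B * B) * (|c| + |s|)) (by fun_prop) fun p => ?_
    rw [abs_mul, abs_mul, mul_assoc (B * B)]
    have h2 : |c * p.2 i - s * p.1 i| ≤ (|c| + |s|) * (1 + ‖p.1‖ + ‖p.2‖) := by
      refine (abs_sub _ _).trans ?_
      rw [abs_mul, abs_mul]
      have h3 := hcoord p.1
      have h4 := hcoord p.2
      nlinarith [norm_nonneg p.1, norm_nonneg p.2, abs_nonneg c, abs_nonneg s,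
        mul_le_mul_of_nonneg_left h3 (abs_nonneg s), mul_le_mul_of_nonneg_left h4 (abs_nonneg c),
        mul_nonneg (abs_nonneg c) (norm_nonneg p.1), mul_nonneg (abs_nonneg s) (norm_nonneg p.2)]
    gcongr
    exacts [hFB _, hHi _]
  · simp only [ContinuousLinearMap.mul_apply']
    refine integrable_mul_gauss2 (C := B * B) (by fun_prop) fun p => ?_
    rw [abs_mul]
    calc _ ≤ (B * B) * 1 := by rw [mul_one]; gcongr; exacts [hFB _, hHi _]
      _ ≤ _ := by gcongr; linarith [norm_nonneg p.1, norm_nonneg p.2]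
  · intro p _
    have h1 : HasDerivAt (fun t : ℝ => p.1 + t • s • EuclideanSpace.single i (1 : ℝ))
        (s • EuclideanSpace.single i (1 : ℝ)) 0 := by
      simpa using ((hasDerivAt_id (0 : ℝ)).smul_const
        (s • EuclideanSpace.single i (1 : ℝ))).const_add p.1
    have h2 : HasGradientAt F (F' p.1) (p.1 + (0 : ℝ) • s • EuclideanSpace.single i (1 : ℝ)) := by
      simpa using hF p.1
    have h3 := (h2.hasFDerivAt.comp_hasDerivAt (0 : ℝ) h1).mul_const (H (c • p.1 + s • p.2) i)
    have h4 : ∀ t : ℝ, c • (p.1 + t • s • EuclideanSpace.single i (1 : ℝ)) +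
        s • (p.2 + t • -c • EuclideanSpace.single i (1 : ℝ)) = c • p.1 + s • p.2 :=
      fun t => by module
    unfold HasLineDerivAt
    simp only [Prod.fst_add, Prod.smul_fst, Prod.snd_add, Prod.smul_snd, h4]
    refine h3.congr_deriv ?_
    rw [InnerProductSpace.toDual_apply_apply, inner_smul_right, EuclideanSpace.inner_single_right]
    simp [mul_assoc]

/-- Gaussian integration by parts along the rotation of a pair of independent vectors. -/
theorem integral_inner_mul_gauss2 {n : ℕ} {F : E n → ℝ} {F' H : E n → E n} {B : ℝ}
    (hF : ∀ x, HasGradientAt F (F' x) x) (hF' : Measurable F') (hH : Measurable H)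
    (hFB : ∀ x, |F x| ≤ B) (hFB' : ∀ x, ‖F' x‖ ≤ B) (hHB : ∀ x, ‖H x‖ ≤ B) (c s : ℝ) :
    ∫ p : E n × E n, F p.1 * ⟪H (c • p.1 + s • p.2), c • p.2 - s • p.1⟫ * gauss2 p =
      -(s * ∫ p : E n × E n, ⟪F' p.1, H (c • p.1 + s • p.2)⟫ * gauss2 p) := by
  have hFc : Continuous F := continuous_iff_continuousAt.2 fun x => (hF x).continuousAt
  have hFm := hFc.measurable
  have hB : 0 ≤ B := (abs_nonneg _).trans (hFB 0)
  have hcoord : ∀ (x : E n) i, |x i| ≤ ‖x‖ := fun x i => PiLp.norm_apply_le x i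
  have hHi : ∀ x i, |H x i| ≤ B := fun x i => (hcoord _ i).trans (hHB x)
  have hFi : ∀ x i, |F' x i| ≤ B := fun x i => (hcoord _ i).trans (hFB' x)
  have e1 : ∀ p : E n × E n, F p.1 * ⟪H (c • p.1 + s • p.2), c • p.2 - s • p.1⟫ * gauss2 p =
      ∑ i, F p.1 * (H (c • p.1 + s • p.2) i * (c * p.2 i - s * p.1 i)) * gauss2 p := by
    intro p
    rw [← Finset.sum_mul, ← Finset.mul_sum]
    congr 2
    simp [PiLp.inner_apply, mul_comm]
  have e2 : ∀ p : E n × E n, ⟪F' p.1, H (c • p.1 + s • p.2)⟫ * gauss2 p =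
      ∑ i, F' p.1 i * H (c • p.1 + s • p.2) i * gauss2 p := by
    intro p
    rw [← Finset.sum_mul]
    congr 1
    simp [PiLp.inner_apply, mul_comm]
  simp_rw [e1, e2]
  rw [integral_finsetSum, integral_finsetSum, Finset.mul_sum, ← Finset.sum_neg_distrib]
  · exact Finset.sum_congr rfl fun i _ =>
      integral_coord_mul_gauss2 hF hF' hH hFB hFB' hHB c s i
  · intro i _
    refine integrable_mul_gauss2 (C := B * B) (by fun_prop) fun p => ?_
    rw [abs_mul]
    calc _ ≤ (B * B) * 1 := by rw [mul_one]; gcongr; exacts [hFi _ _, hHi _ _]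
      _ ≤ _ := by gcongr; linarith [norm_nonneg p.1, norm_nonneg p.2]
  · intro i _
    refine integrable_mul_gauss2 (C := (B * B) * (|c| + |s|)) (by fun_prop) fun p => ?_
    rw [abs_mul, abs_mul, ← mul_assoc, mul_assoc (B * B)]
    have h2 : |c * p.2 i - s * p.1 i| ≤ (|c| + |s|) * (1 + ‖p.1‖ + ‖p.2‖) := by
      refine (abs_sub _ _).trans ?_
      rw [abs_mul, abs_mul]
      have h3 := hcoord p.1 i
      have h4 := hcoord p.2 i
      nlinarith [norm_nonneg p.1, norm_nonneg p.2, abs_nonneg c, abs_nonneg s,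
        mul_le_mul_of_nonneg_left h3 (abs_nonneg s), mul_le_mul_of_nonneg_left h4 (abs_nonneg c),
        mul_nonneg (abs_nonneg c) (norm_nonneg p.1), mul_nonneg (abs_nonneg s) (norm_nonneg p.2)]
    gcongr
    exacts [hFB _, hHi _ _]

/-- The point at angle `θ` on the arc from `p.1` to `p.2`. -/
def arc {n : ℕ} (q : ℝ × (E n × E n)) : E n := Real.cos q.1 • q.2.1 + Real.sin q.1 • q.2.2

@[fun_prop]
theorem continuous_arc {n : ℕ} : Continuous (arc (n := n)) := by unfold arc; fun_prop

@[fun_prop]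
theorem measurable_arc {n : ℕ} : Measurable (arc (n := n)) := continuous_arc.measurable

/-- Lebesgue measure on angles in `(0, π / 2)` and pairs of vectors. -/
def arcMeasure (n : ℕ) : Measure (ℝ × (E n × E n)) :=
  ((volume : Measure ℝ).restrict (Ioo 0 (π / 2))).prod volume

/-- The Gaussian covariance representation for bounded functions with bounded gradients. -/
theorem gaussian_covariance {n : ℕ} {F G : E n → ℝ} {F' G' : E n → E n} {B : ℝ}
    (hF : ∀ x, HasGradientAt F (F' x) x) (hG : ∀ x, HasGradientAt G (G' x) x)
    (hF' : Measurable F') (hG' : Measurable G') (hFB : ∀ x, |F x| ≤ B)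
    (hFB' : ∀ x, ‖F' x‖ ≤ B) (hGB' : ∀ x, ‖G' x‖ ≤ B) :
    ∫ p : E n × E n, F p.1 * (G p.1 - G p.2) * gauss2 p =
      ∫ q, Real.sin q.1 * ⟪F' q.2.1, G' (arc q)⟫ * gauss2 q.2 ∂arcMeasure n := by
  have hFc : Continuous F := continuous_iff_continuousAt.2 fun x => (hF x).continuousAt
  have hFm := hFc.measurable
  have hB : 0 ≤ B := (abs_nonneg _).trans (hFB 0)
  -- `T` is F(x) times the θ-derivative of `G` along the arc. Its linear growth in the pair, against
  -- the Gaussian density, justifies exchanging the integrals over θ and over the pair.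
  set T : ℝ × (E n × E n) → ℝ := fun q => F q.2.1 * ⟪G' (Real.cos q.1 • q.2.1 + Real.sin q.1 • q.2.2),
    Real.cos q.1 • q.2.2 - Real.sin q.1 • q.2.1⟫ with hT
  have hTm : Measurable T := by fun_prop
  have hTb : ∀ q, |T q| ≤ (B * B) * (1 + ‖q.2.1‖ + ‖q.2.2‖) := by
    intro q
    rw [hT, abs_mul, mul_assoc B]
    refine mul_le_mul (hFB _) ?_ (abs_nonneg _) hB
    refine (abs_real_inner_le_norm _ _).trans ?_
    refine mul_le_mul (hGB' _) ?_ (norm_nonneg _) hB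
    refine (norm_sub_le _ _).trans ?_
    rw [norm_smul, norm_smul]
    have h1 := mul_le_mul_of_nonneg_right (Real.abs_cos_le_one q.1) (norm_nonneg q.2.2)
    have h2 := mul_le_mul_of_nonneg_right (Real.abs_sin_le_one q.1) (norm_nonneg q.2.1)
    rw [Real.norm_eq_abs, Real.norm_eq_abs]
    linarith
  have ftc : ∀ p : E n × E n, F p.1 * (G p.1 - G p.2) * gauss2 p =
      -∫ θ in Ioo 0 (π / 2), T (θ, p) * gauss2 p := by
    intro p
    have hd : ∀ θ ∈ uIcc 0 (π / 2), HasDerivAt (fun θ : ℝ =>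
        F p.1 * G (Real.cos θ • p.1 + Real.sin θ • p.2)) (T (θ, p)) θ := by
      intro θ _
      have h1 : HasDerivAt (fun θ : ℝ => Real.cos θ • p.1 + Real.sin θ • p.2)
          (Real.cos θ • p.2 - Real.sin θ • p.1) θ := by
        convert! ((Real.hasDerivAt_cos θ).smul_const p.1).add
          ((Real.hasDerivAt_sin θ).smul_const p.2) using 1
        module
      have h2 := ((hG _).hasFDerivAt.comp_hasDerivAt θ h1).const_mul (F p.1)
      simpa using h2
    have hi : IntervalIntegrable (fun θ => T (θ, p)) volume 0 (π / 2) := by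
      refine (intervalIntegrable_const (c := (B * B) * (1 + ‖p.1‖ + ‖p.2‖))).mono_fun
        (hTm.comp measurable_prodMk_right).aestronglyMeasurable (.of_forall fun θ => ?_)
      refine (hTb (θ, p)).trans (le_abs_self _)
    have h3 := intervalIntegral.integral_eq_sub_of_hasDerivAt hd hi
    rw [intervalIntegral.integral_of_le (by positivity), integral_Ioc_eq_integral_Ioo] at h3
    rw [integral_mul_const, h3]
    simp
    ring
  have hint : Integrable (fun q => T q * gauss2 q.2) (arcMeasure n) := by
    refine (((integrable_gauss2_dominant n).const_mul (B * B)).comp_snd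
      ((volume : Measure ℝ).restrict (Ioo 0 (π / 2)))).mono' (by fun_prop) (.of_forall fun q => ?_)
    rw [norm_mul, Real.norm_eq_abs, Real.norm_of_nonneg (gauss2_pos _).le, ← mul_assoc]
    exact mul_le_mul_of_nonneg_right (hTb q) (gauss2_pos _).le
  have hint2 : Integrable (fun q => Real.sin q.1 * ⟪F' q.2.1, G' (arc q)⟫ * gauss2 q.2)
      (arcMeasure n) := by
    refine (((integrable_gauss2_dominant n).const_mul (B * B)).comp_snd
      ((volume : Measure ℝ).restrict (Ioo 0 (π / 2)))).mono' (by fun_prop) (.of_forall fun q => ?_)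
    rw [norm_mul, norm_mul, Real.norm_eq_abs, Real.norm_eq_abs, Real.norm_of_nonneg (gauss2_pos _).le,
      ← mul_assoc]
    refine mul_le_mul_of_nonneg_right ?_ (gauss2_pos _).le
    calc _ ≤ 1 * (B * B) := by
          gcongr
          · exact Real.abs_sin_le_one _
          · refine (abs_real_inner_le_norm _ _).trans ?_
            gcongr
            exacts [hFB' _, hGB' _]
      _ ≤ _ := by nlinarith [norm_nonneg q.2.1, norm_nonneg q.2.2, mul_nonneg hB hB]
  rw [integral_congr_ae (.of_forall ftc), integral_neg]
  rw [arcMeasure] at hint hint2 ⊢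
  rw [integral_prod _ hint2, ← integral_prod_symm _ hint, integral_prod _ hint, ← integral_neg]
  refine integral_congr_ae (.of_forall fun θ => ?_)
  have := integral_inner_mul_gauss2 hF hF' hG' hFB hFB' hGB' (Real.cos θ) (Real.sin θ)
  simp only [hT, arc, mul_assoc (Real.sin θ), integral_const_mul]
  rw [this, neg_neg]

/-! ### From random arcs to the measure `nu`. -/

theorem lintegral_eq_mul_lintegral_comp_smul {n : ℕ} {s : ℝ} (hs : 0 < s) {H : E n → ℝ≥0∞}
    (hH : Measurable H) : ∫⁻ x, H x = ENNReal.ofReal (s ^ n) * ∫⁻ x, H (s • x) := by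
  have h := lintegral_map (μ := (volume : Measure (E n))) hH (measurable_const_smul s)
  rw [Measure.map_addHaar_smul _ hs.ne', lintegral_smul_measure, finrank_euclideanSpace,
    Fintype.card_fin, smul_eq_mul, abs_of_pos (by positivity)] at h
  rw [← h, ← mul_assoc, ← ENNReal.ofReal_mul (by positivity),
    mul_inv_cancel₀ (by positivity), ENNReal.ofReal_one, one_mul]

/-- The exponential factor of the joint density of two standard Gaussian vectors of
correlation `t`, after rescaling. -/
def mehler {n : ℕ} (t : ℝ) (p : E n × E n) : ℝ :=
  rexp (-((‖p.1‖ ^ 2 + ‖p.2‖ ^ 2 - 2 * t * ⟪p.1, p.2⟫) / 2))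

@[fun_prop]
theorem measurable_mehler {n : ℕ} {α : Type*} [MeasurableSpace α] {t : α → ℝ} {f : α → E n × E n}
    (ht : Measurable t) (hf : Measurable f) : Measurable fun a => mehler (t a) (f a) := by
  unfold mehler; fun_prop

/-- The unnormalized density of the directions of two correlated Gaussian vectors against
a test function. -/
def mehlerIntegral {n : ℕ} (e : S n) (h : S n × S n → ℝ≥0∞) (t : ℝ) : ℝ≥0∞ :=
  ∫⁻ x : E n, ∫⁻ y : E n, ENNReal.ofReal (‖x‖⁻¹ * ‖y‖⁻¹ * mehler t (x, y)) *
    h (radial e x, radial e y)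

/-- Replace the first vector by sin θ x and the second by y - cos θ x. Then the arc point becomes
sin θ y, so both directions are those of x and y, and the Gaussian exponent becomes the one in
`mehler` with t = cos θ. -/
theorem lintegral_arc_eq_mehler {n : ℕ} (hn : 2 ≤ n) (e : S n) {h : S n × S n → ℝ≥0∞}
    (hh : Measurable h) {θ : ℝ} (hθ : θ ∈ Ioo 0 (π / 2)) :
    ∫⁻ p : E n × E n, ENNReal.ofReal
        (Real.sin θ * (‖p.1‖⁻¹ * ‖arc (θ, p)‖⁻¹) * gauss2 p) *
        h (radial e p.1, radial e (arc (θ, p))) =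
      ENNReal.ofReal (Real.sin θ) * (ENNReal.ofReal (√(1 - Real.cos θ ^ 2) ^ (n - 2)) *
        mehlerIntegral e h (Real.cos θ)) := by
  have hs : 0 < Real.sin θ := Real.sin_pos_of_pos_of_lt_pi hθ.1 (by linarith [hθ.2, Real.pi_pos])
  have hsq : √(1 - Real.cos θ ^ 2) = Real.sin θ := by
    rw [← Real.sin_sq, Real.sqrt_sq hs.le]
  rw [hsq, Measure.volume_eq_prod, lintegral_prod _ (by fun_prop),
    lintegral_eq_mul_lintegral_comp_smul hs
      (Measurable.lintegral_prod_right (by fun_prop)), mehlerIntegral, ← mul_assoc,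
    ← ENNReal.ofReal_mul hs.le]
  -- The Jacobian is sin^n θ. The two inverse norms release sin⁻² θ against the weight sin θ, so the
  -- last factor split off here cancels what remains; sin^{n-2} θ gives the power of √(1 - t²), and
  -- the other sin θ becomes dt.
  have e1 : ENNReal.ofReal (Real.sin θ ^ n) =
      ENNReal.ofReal (Real.sin θ * Real.sin θ ^ (n - 2)) * ENNReal.ofReal (Real.sin θ) := by
    rw [← ENNReal.ofReal_mul (by positivity)]
    congr 1
    obtain ⟨m, rfl⟩ := Nat.exists_eq_add_of_le' hn
    simp only [Nat.add_sub_cancel]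
    ring
  rw [e1, mul_assoc, ← lintegral_const_mul _ (Measurable.lintegral_prod_right (by fun_prop))]
  congr 1
  refine lintegral_congr fun x => ?_
  rw [← lintegral_sub_right_eq_self _ (Real.cos θ • x), ← lintegral_const_mul _ (by fun_prop)]
  refine lintegral_congr fun y => ?_
  have harc : arc (θ, (Real.sin θ • x, y - Real.cos θ • x)) = Real.sin θ • y := by
    simp only [arc]; module
  rw [harc, radial_smul e hs, radial_smul e hs, ← mul_assoc, ← ENNReal.ofReal_mul hs.le]
  congr 2
  have hexp : gauss2 (Real.sin θ • x, y - Real.cos θ • x) = mehler (Real.cos θ) (x, y) := by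
    rw [gauss2, mehler]
    congr 3
    simp only [norm_smul, norm_sub_sq_real, mul_pow, inner_smul_right, Real.norm_eq_abs, sq_abs]
    rw [real_inner_comm x y, Real.sin_sq]
    ring
  rw [hexp, norm_smul, norm_smul, Real.norm_of_nonneg hs.le, mul_inv, mul_inv]
  field_simp

theorem lintegral_sin_mul_comp_cos (Φ : ℝ → ℝ≥0∞) :
    ∫⁻ θ in Ioo 0 (π / 2), ENNReal.ofReal (Real.sin θ) * Φ (Real.cos θ) =
      ∫⁻ t in Ioo (0 : ℝ) 1, Φ t := by
  have himg : Real.cos '' Ioo 0 (π / 2) = Ioo 0 1 := by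
    ext t
    constructor
    · rintro ⟨θ, hθ, rfl⟩
      refine ⟨Real.cos_pos_of_mem_Ioo ⟨by linarith [hθ.1, Real.pi_pos], hθ.2⟩, ?_⟩
      rw [← Real.cos_zero]
      exact Real.cos_lt_cos_of_nonneg_of_le_pi_div_two le_rfl hθ.2.le hθ.1
    · intro ht
      exact ⟨Real.arccos t, ⟨Real.arccos_pos.2 ht.2, Real.arccos_lt_pi_div_two.2 ht.1⟩,
        Real.cos_arccos (by linarith [ht.1]) ht.2.le⟩
  rw [← himg, lintegral_image_eq_lintegral_abs_deriv_mul measurableSet_Ioo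
    (fun θ _ => (Real.hasDerivAt_cos θ).hasDerivWithinAt)
    (Real.injOn_cos.mono fun θ hθ =>
      (⟨hθ.1.le, by linarith [hθ.2, Real.pi_pos]⟩ : θ ∈ Icc 0 π))]
  refine setLIntegral_congr_fun measurableSet_Ioo fun θ hθ => ?_
  simp only [abs_neg]
  rw [abs_of_pos (Real.sin_pos_of_pos_of_lt_pi hθ.1 (by linarith [hθ.2, Real.pi_pos]))]

/-- The inner double integral in the definition of `psi`. -/
def radialIntegral (n : ℕ) (t α : ℝ) : ℝ≥0∞ :=
  ∫⁻ r in Ioi (0 : ℝ), ∫⁻ r' in Ioi (0 : ℝ),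
    ENNReal.ofReal (Real.exp (-((r ^ 2 + r' ^ 2 - 2 * r * r' * t * α) / 2)) * (r * r') ^ (n - 2))

theorem psi_eq (n : ℕ) (α : ℝ) :
    psi n α = ENNReal.ofReal (1 / (2 ^ (n - 2) * Real.Gamma ((n : ℝ) / 2) ^ 2)) *
      ∫⁻ t in Ioo (0 : ℝ) 1, ENNReal.ofReal (√(1 - t ^ 2) ^ (n - 2)) * radialIntegral n t α := rfl

theorem measurable_radialIntegral_uncurry (n : ℕ) :
    Measurable fun p : ℝ × ℝ => radialIntegral n p.1 p.2 := by
  have h1 : Measurable fun q : (ℝ × ℝ) × ℝ => ∫⁻ r' in Ioi (0 : ℝ),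
    ENNReal.ofReal (Real.exp (-((q.2 ^ 2 + r' ^ 2 - 2 * q.2 * r' * q.1.1 * q.1.2) / 2)) *
      (q.2 * r') ^ (n - 2)) := Measurable.lintegral_prod_right (by fun_prop)
  exact h1.lintegral_prod_right'

attribute [irreducible] radialIntegral

@[fun_prop]
theorem measurable_radialIntegral (n : ℕ) {α : Type*} [MeasurableSpace α] {t a : α → ℝ}
    (ht : Measurable t) (ha : Measurable a) : Measurable fun x => radialIntegral n (t x) (a x) :=
  (measurable_radialIntegral_uncurry n).comp (ht.prodMk ha)

@[fun_prop]
theorem measurable_psi (n : ℕ) : Measurable (psi n) := by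
  have e := funext (psi_eq n)
  rw [e]
  exact Measurable.const_mul (Measurable.lintegral_prod_right (by fun_prop)) _

/-- Polar coordinates in both variables: the inverse norms lower each radial exponent from n - 1 to
n - 2, which is the power of r r' in the definition of `psi`. -/
theorem mehlerIntegral_eq {n : ℕ} (hn : 2 ≤ n) (e : S n) {h : S n × S n → ℝ≥0∞}
    (hh : Measurable h) (t : ℝ) :
    mehlerIntegral e h t = ∫⁻ p, radialIntegral n t ⟪(p.1 : E n), (p.2 : E n)⟫ * h p
      ∂((volume : Measure (E n)).toSphere.prod (volume : Measure (E n)).toSphere) := by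
  rw [lintegral_prod _ (by fun_prop), mehlerIntegral,
    lintegral_polar (by omega) (Measurable.lintegral_prod_right (by fun_prop))]
  refine lintegral_congr fun ξ => ?_
  have e1 : ∀ r ∈ Ioi (0 : ℝ), ENNReal.ofReal (r ^ (n - 1)) *
      ∫⁻ y : E n, ENNReal.ofReal (‖r • (ξ : E n)‖⁻¹ * ‖y‖⁻¹ * mehler t (r • (ξ : E n), y)) *
        h (radial e (r • (ξ : E n)), radial e y) =
      ∫⁻ η : S n, (∫⁻ r' in Ioi (0 : ℝ), ENNReal.ofReal (Real.exp (-((r ^ 2 + r' ^ 2 -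
        2 * r * r' * t * ⟪(ξ : E n), (η : E n)⟫) / 2)) * (r * r') ^ (n - 2))) * h (ξ, η)
        ∂(volume : Measure (E n)).toSphere := by
    intro r hr
    rw [lintegral_polar (by omega) (by fun_prop), ← lintegral_const_mul _
      (Measurable.lintegral_prod_right (by fun_prop))]
    refine lintegral_congr fun η => ?_
    rw [← lintegral_const_mul _ (by fun_prop), ← lintegral_mul_const _ (by fun_prop)]
    refine setLIntegral_congr_fun measurableSet_Ioi fun r' hr' => ?_
    have hr : 0 < r := hr
    have hr' : 0 < r' := hr'
    rw [radial_smul_coe e hr, radial_smul_coe e hr', ← mul_assoc, ← mul_assoc,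
      ← ENNReal.ofReal_mul (by positivity), ← ENNReal.ofReal_mul (by positivity)]
    congr 2
    simp only [mehler, norm_smul, norm_coe, Real.norm_of_nonneg hr.le, Real.norm_of_nonneg hr'.le,
      real_inner_smul_left, real_inner_smul_right, mul_one]
    obtain ⟨m, rfl⟩ := Nat.exists_eq_add_of_le' hn
    have e2 : m + 2 - 1 = m + 1 := rfl
    rw [e2, Nat.add_sub_cancel, mul_pow, pow_succ, pow_succ]
    field_simp
  rw [setLIntegral_congr_fun measurableSet_Ioi e1, lintegral_lintegral_swap]
  · refine lintegral_congr fun η => ?_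
    rw [lintegral_mul_const _ (Measurable.lintegral_prod_right (by fun_prop)), radialIntegral]
  · refine Measurable.aemeasurable (Measurable.mul ?_ (by fun_prop))
    exact Measurable.lintegral_prod_right (by fun_prop)

/-- This is the origin of the prefactor of `psi`: it is the squared area of the sphere divided by
(2π)^n, the squared Gaussian normalization. -/
theorem toSphere_univ_mul_self {n : ℕ} (hn : 2 ≤ n) :
    (volume : Measure (E n)).toSphere univ * (volume : Measure (E n)).toSphere univ =
      ENNReal.ofReal ((2 * π) ^ n) *
        ENNReal.ofReal (1 / (2 ^ (n - 2) * Real.Gamma ((n : ℝ) / 2) ^ 2)) := by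
  have hn' : (0 : ℝ) < n := by exact_mod_cast (by omega : 0 < n)
  have hG := Real.Gamma_pos_of_pos (half_pos hn')
  rw [toSphere_univ (by omega), ← ENNReal.ofReal_mul (by positivity),
    ← ENNReal.ofReal_mul (by positivity)]
  congr 1
  have hpi : π ^ ((n : ℝ) / 2) * π ^ ((n : ℝ) / 2) = π ^ n := by
    rw [← Real.rpow_add Real.pi_pos, add_halves, Real.rpow_natCast]
  have h2 : (2 : ℝ) ^ n = 2 ^ (n - 2) * 4 := by
    obtain ⟨m, rfl⟩ := Nat.exists_eq_add_of_le' hn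
    rw [Nat.add_sub_cancel, pow_add]
    norm_num
  rw [mul_pow, ← hpi, h2]
  field_simp
  norm_num

/-- The measure `nu n` is, up to a constant, the joint law of the directions of the endpoints of a
random arc between Gaussian vectors, weighted by the inverse norms of the endpoints. -/
theorem lintegral_arcMeasure {n : ℕ} (hn : 2 ≤ n) (e : S n) {h : S n × S n → ℝ≥0∞}
    (hh : Measurable h) :
    ∫⁻ q, ENNReal.ofReal (Real.sin q.1 * (‖q.2.1‖⁻¹ * ‖arc q‖⁻¹) * gauss2 q.2) *
        h (radial e q.2.1, radial e (arc q)) ∂arcMeasure n =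
      ENNReal.ofReal ((2 * π) ^ n) * ∫⁻ p, h p ∂nu n := by
  rw [arcMeasure, lintegral_prod _ (by fun_prop),
    setLIntegral_congr_fun measurableSet_Ioo fun θ hθ => lintegral_arc_eq_mehler hn e hh hθ,
    lintegral_sin_mul_comp_cos
      (fun t => ENNReal.ofReal (√(1 - t ^ 2) ^ (n - 2)) * mehlerIntegral e h t)]
  have e1 : ∀ t, ENNReal.ofReal (√(1 - t ^ 2) ^ (n - 2)) * mehlerIntegral e h t =
      ∫⁻ p, ENNReal.ofReal (√(1 - t ^ 2) ^ (n - 2)) *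
        (radialIntegral n t ⟪(p.1 : E n), (p.2 : E n)⟫ * h p)
      ∂((volume : Measure (E n)).toSphere.prod (volume : Measure (E n)).toSphere) := by
    intro t
    rw [mehlerIntegral_eq hn e hh, lintegral_const_mul _ (by fun_prop)]
  have := isProbabilityMeasure_sigma (n := n) (by omega)
  rw [lintegral_congr e1, lintegral_lintegral_swap (by fun_prop),
    toSphere_eq_smul_sigma (by omega), Measure.prod_smul_left, Measure.prod_smul_right,
    smul_smul, lintegral_smul_measure, smul_eq_mul, toSphere_univ_mul_self hn, mul_assoc, nu,
    lintegral_withDensity_eq_lintegral_mul _ (by fun_prop) hh,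
    ← lintegral_const_mul _ (Measurable.lintegral_prod_left (by fun_prop))]
  congr 1
  refine lintegral_congr fun p => ?_
  rw [Pi.mul_apply, psi_eq, mul_assoc, ← lintegral_mul_const _ (by fun_prop)]
  simp_rw [mul_assoc]

/-! ### Finiteness of `nu` and integrability of the singular weight. -/

theorem integrableOn_inv_norm_ball {n : ℕ} (hn : 2 ≤ n) :
    IntegrableOn (fun x : E n => ‖x‖⁻¹) (ball 0 1) := by
  have : NeZero n := ⟨by omega⟩
  rw [integrableOn_fun_norm_addHaar volume (f := fun r => r⁻¹)]
  have h1 : IntegrableOn (fun r : ℝ => r ^ (n - 2)) (Ioo 0 1) :=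
    ((continuous_pow (n - 2)).integrableOn_Icc (a := 0) (b := 1)).mono_set Ioo_subset_Icc_self
  refine h1.congr_fun (fun r hr => ?_) measurableSet_Ioo
  have hr : r ≠ 0 := hr.1.ne'
  obtain ⟨m, rfl⟩ := Nat.exists_eq_add_of_le' hn
  have e2 : m + 2 - 1 = m + 1 := rfl
  simp only [finrank_euclideanSpace, Fintype.card_fin, e2, Nat.add_sub_cancel, smul_eq_mul]
  rw [pow_succ, mul_assoc, mul_inv_cancel₀ hr, mul_one]

/-- Where |z + b| ≥ 1 the inverse norm is at most 1; where |z + b| < 1 the Gaussian factor is at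
most 1 and |z + b|⁻¹ is integrable. Translation invariance makes the bound independent of b. -/
theorem exists_lintegral_inv_norm_add_le {n : ℕ} (hn : 2 ≤ n) : ∃ C : ℝ≥0∞, C ≠ ⊤ ∧ ∀ b : E n,
    ∫⁻ z : E n, ENNReal.ofReal (‖z + b‖⁻¹ * rexp (-(‖z‖ ^ 2 / 2))) ≤ C := by
  refine ⟨(∫⁻ z : E n, ENNReal.ofReal (rexp (-(‖z‖ ^ 2 / 2)))) +
    ∫⁻ z : E n, (ball (0 : E n) 1).indicator (fun z => ENNReal.ofReal ‖z‖⁻¹) z, ?_, fun b => ?_⟩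
  · rw [lintegral_gaussian, lintegral_indicator measurableSet_ball]
    refine ENNReal.add_ne_top.2 ⟨ENNReal.ofReal_ne_top, ?_⟩
    exact (lintegral_ofReal_ne_top_iff_integrable (by fun_prop)
      (.of_forall fun _ => by positivity)).2 (integrableOn_inv_norm_ball hn)
  · rw [← lintegral_add_right_eq_self
      (fun z => (ball (0 : E n) 1).indicator (fun z => ENNReal.ofReal ‖z‖⁻¹) z) b,
      ← lintegral_add_left (by fun_prop)]
    refine lintegral_mono fun z => ?_
    have hw : rexp (-(‖z‖ ^ 2 / 2)) ≤ 1 := Real.exp_le_one_iff.2 (by simp; positivity)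
    by_cases hz : z + b ∈ ball (0 : E n) 1
    · rw [indicator_of_mem hz]
      refine le_add_left (ENNReal.ofReal_le_ofReal ?_)
      exact mul_le_of_le_one_right (by positivity) hw
    · refine le_add_right (ENNReal.ofReal_le_ofReal ?_)
      refine mul_le_of_le_one_left (exp_pos _).le (inv_le_one_of_one_le₀ ?_)
      simpa using hz

/-- The arc point is sin θ (z + cot θ x), so the weight sin θ cancels the factor 1/sin θ coming from
its inverse norm. The uniform bound applies to the integral over z and then to the one over x,
leaving a bound independent of θ on a bounded interval. -/
theorem lintegral_arcMeasure_ne_top {n : ℕ} (hn : 2 ≤ n) :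
    ∫⁻ q, ENNReal.ofReal (Real.sin q.1 * (‖q.2.1‖⁻¹ * ‖arc q‖⁻¹) * gauss2 q.2) ∂arcMeasure n ≠
      ⊤ := by
  obtain ⟨C, hC, hb⟩ := exists_lintegral_inv_norm_add_le hn
  refine ne_top_of_le_ne_top (b := ∫⁻ θ in Ioo 0 (π / 2), C * C) ?_ ?_
  · simp [ENNReal.mul_eq_top, hC]
  rw [arcMeasure, lintegral_prod _ (by fun_prop)]
  refine setLIntegral_mono measurable_const fun θ hθ => ?_
  have hs : 0 < Real.sin θ := Real.sin_pos_of_pos_of_lt_pi hθ.1 (by linarith [hθ.2, Real.pi_pos])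
  rw [Measure.volume_eq_prod, lintegral_prod _ (by fun_prop)]
  -- The `+ 0` puts the outer integral in the form of the same uniform bound, with b = 0.
  calc _ ≤ ∫⁻ x : E n, ENNReal.ofReal (‖x + 0‖⁻¹ * rexp (-(‖x‖ ^ 2 / 2))) * C := by
        refine lintegral_mono fun x => ?_
        grw [← hb ((Real.cos θ / Real.sin θ) • x)]
        rw [← lintegral_const_mul _ (by fun_prop)]
        refine lintegral_mono fun z => le_of_eq ?_
        rw [← ENNReal.ofReal_mul (by positivity)]
        congr 1
        have harc : arc (θ, (x, z)) = Real.sin θ • (z + (Real.cos θ / Real.sin θ) • x) := by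
          rw [arc, smul_add, smul_smul, mul_div_cancel₀ _ hs.ne', add_comm]
        rw [harc, norm_smul, Real.norm_of_nonneg hs.le, mul_inv, gauss2_eq_mul, add_zero]
        field_simp
    _ ≤ _ := by
        rw [lintegral_mul_const _ (by fun_prop)]
        grw [hb 0]

theorem nu_univ_ne_top {n : ℕ} (hn : 2 ≤ n) : nu n univ ≠ ⊤ := by
  have : NeZero n := ⟨by omega⟩
  have e : S n := ⟨EuclideanSpace.single 0 1, by simp⟩
  have h := lintegral_arcMeasure hn e (h := fun _ => 1) measurable_const
  simp only [mul_one, lintegral_const, one_mul] at h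
  intro h'
  rw [h', ENNReal.mul_top (ENNReal.ofReal_pos.2 (by positivity)).ne'] at h
  exact lintegral_arcMeasure_ne_top hn h

theorem ae_arcMeasure_sin_pos (n : ℕ) : ∀ᵐ q ∂arcMeasure n, 0 < Real.sin q.1 := by
  have h : ∀ᵐ θ ∂(volume : Measure ℝ).restrict (Ioo 0 (π / 2)), 0 < Real.sin θ := by
    filter_upwards [ae_restrict_mem measurableSet_Ioo] with θ hθ
    exact Real.sin_pos_of_pos_of_lt_pi hθ.1 (by linarith [hθ.2, Real.pi_pos])
  exact Measure.quasiMeasurePreserving_fst.ae h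

theorem integrable_arc_dominant {n : ℕ} (hn : 2 ≤ n) :
    Integrable (fun q => Real.sin q.1 * (‖q.2.1‖⁻¹ * ‖arc q‖⁻¹) * gauss2 q.2) (arcMeasure n) := by
  refine (lintegral_ofReal_ne_top_iff_integrable (by fun_prop) ?_).1
    (lintegral_arcMeasure_ne_top hn)
  filter_upwards [ae_arcMeasure_sin_pos n] with q hq
  have := gauss2_pos q.2
  simp only [Pi.zero_apply]
  positivity

/-! ### Removal of the singularity at the origin. -/

/-- The factor that regularizes a function which is singular at the origin. -/
def damp {n : ℕ} (ε : ℝ) (x : E n) : ℝ := ‖x‖ ^ 2 / (‖x‖ ^ 2 + ε)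

/-- The gradient of `damp ε * F`, where `F'` is the gradient of `F`. -/
def dampGradient {n : ℕ} (ε : ℝ) (F : E n → ℝ) (F' : E n → E n) (x : E n) : E n :=
  damp ε x • F' x + (F x * (2 * ε / (‖x‖ ^ 2 + ε) ^ 2)) • x

section damp

variable {n : ℕ} {ε B : ℝ} {F : E n → ℝ} {F' : E n → E n}

theorem damp_nonneg (hε : 0 < ε) (x : E n) : 0 ≤ damp ε x := by unfold damp; positivity

theorem damp_le_one (hε : 0 < ε) (x : E n) : damp ε x ≤ 1 := by
  unfold damp
  exact div_le_one_of_le₀ (by linarith) (by positivity)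

/-- At the origin the product is O(|x|²) because `F` is bounded, hence differentiable there with
zero gradient although `F` may be discontinuous. Elsewhere this is the product rule. -/
theorem hasGradientAt_damp_mul (hε : 0 < ε) (hF : ∀ x, x ≠ 0 → HasGradientAt F (F' x) x)
    (hFB : ∀ x, |F x| ≤ B) (x : E n) :
    HasGradientAt (fun x => damp ε x * F x) (dampGradient ε F F' x) x := by
  rcases eq_or_ne x 0 with rfl | hx
  · have h0 : dampGradient ε F F' 0 = 0 := by simp [dampGradient, damp]
    rw [h0, hasGradientAt_iff_hasFDerivAt, map_zero, hasFDerivAt_iff_isLittleO_nhds_zero]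
    have h1 : (fun h : E n => damp ε (0 + h) * F (0 + h) - damp ε (0 : E n) * F 0 -
        (0 : E n →L[ℝ] ℝ) h) =O[𝓝 0] fun h : E n => ‖h‖ ^ 2 := by
      refine Asymptotics.IsBigO.of_bound (B / ε) (.of_forall fun h => ?_)
      have hB := (abs_nonneg _).trans (hFB h)
      simp only [zero_add, zero_apply, sub_zero, Real.norm_eq_abs, abs_pow, abs_norm]
      have h2 : damp ε (0 : E n) = 0 := by simp [damp]
      have h3 : damp ε h ≤ ‖h‖ ^ 2 / ε := by
        unfold damp
        exact div_le_div_of_nonneg_left (by positivity) hε (by nlinarith [norm_nonneg h])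
      rw [h2, zero_mul, sub_zero, abs_mul, abs_of_nonneg (damp_nonneg hε h)]
      calc _ ≤ ‖h‖ ^ 2 / ε * B := by gcongr; exact hFB h
        _ = _ := by ring
    refine h1.trans_isLittleO ?_
    have := (Asymptotics.isLittleO_pow_id (𝕜 := ℝ) one_lt_two).comp_tendsto
      (tendsto_norm_zero (E := E n))
    exact this.trans_isBigO ((Asymptotics.isBigO_refl _ _).norm_left)
  · have hd : HasFDerivAt (fun x : E n => ‖x‖ ^ 2) _ x := (hasFDerivAt_id x).norm_sq
    have hpos : ‖x‖ ^ 2 + ε ≠ 0 := by positivity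
    have h1 := (hd.mul ((hasDerivAt_inv hpos).comp_hasFDerivAt x (hd.add_const ε))).mul
      (hF x hx).hasFDerivAt
    rw [hasGradientAt_iff_hasFDerivAt]
    refine (h1.congr_fderiv ?_)
    ext y
    simp [dampGradient, damp]
    field_simp
    ring

/-- The majorant is used in two ways: for fixed ε it is bounded, so the regular covariance identity
applies; and it is at most 3B/|x| for every ε, which gives the domination as ε tends to 0. -/
theorem norm_dampGradient_le (hε : 0 < ε) (hFB : ∀ x, |F x| ≤ B)
    (hFB' : ∀ x, ‖F' x‖ ≤ B * ‖x‖⁻¹) (x : E n) :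
    ‖dampGradient ε F F' x‖ ≤ 3 * B * (‖x‖ / (‖x‖ ^ 2 + ε)) := by
  have hB := (abs_nonneg _).trans (hFB x)
  have h1 : ‖damp ε x • F' x‖ ≤ B * (‖x‖ / (‖x‖ ^ 2 + ε)) := by
    rw [norm_smul, Real.norm_of_nonneg (damp_nonneg hε x)]
    rcases eq_or_ne x 0 with rfl | hx
    · simp [damp]
    have hx := norm_pos_iff.2 hx
    calc _ ≤ damp ε x * (B * ‖x‖⁻¹) := by
          gcongr
          exacts [damp_nonneg hε x, hFB' x]
      _ = _ := by unfold damp; field_simp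
  have h2 : ‖(F x * (2 * ε / (‖x‖ ^ 2 + ε) ^ 2)) • x‖ ≤ 2 * B * (‖x‖ / (‖x‖ ^ 2 + ε)) := by
    rw [norm_smul, norm_mul, Real.norm_eq_abs, Real.norm_of_nonneg (by positivity)]
    have h3 : 2 * ε / (‖x‖ ^ 2 + ε) ^ 2 ≤ 2 / (‖x‖ ^ 2 + ε) := by
      rw [div_le_div_iff₀ (by positivity) (by positivity)]
      nlinarith [norm_nonneg x, sq_nonneg ‖x‖, mul_nonneg hε.le (sq_nonneg ‖x‖),
        mul_nonneg (sq_nonneg ‖x‖) (sq_nonneg ‖x‖)]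
    calc _ ≤ B * (2 / (‖x‖ ^ 2 + ε)) * ‖x‖ := by
          gcongr
          exact hFB x
      _ = _ := by ring
  refine (norm_add_le _ _).trans ((add_le_add h1 h2).trans (le_of_eq (by ring)))

theorem norm_div_norm_sq_add_le_inv (hε : 0 < ε) (x : E n) : ‖x‖ / (‖x‖ ^ 2 + ε) ≤ ‖x‖⁻¹ := by
  rcases eq_or_ne x 0 with rfl | hx
  · simp
  have hx := norm_pos_iff.2 hx
  rw [div_le_iff₀ (by positivity)]
  field_simp
  linarith

theorem norm_div_norm_sq_add_le (hε : 0 < ε) (x : E n) : ‖x‖ / (‖x‖ ^ 2 + ε) ≤ 1 + 1 / ε := by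
  rw [div_le_iff₀ (by positivity)]
  have h : (1 + 1 / ε) * (‖x‖ ^ 2 + ε) = ‖x‖ ^ 2 + ε + ‖x‖ ^ 2 / ε + 1 := by field_simp; ring
  rw [h]
  have : 0 ≤ ‖x‖ ^ 2 / ε := by positivity
  nlinarith [sq_nonneg (‖x‖ - 1)]

theorem tendsto_damp {e : ℕ → ℝ} (he : Tendsto e atTop (𝓝 0)) {x : E n} (hx : x ≠ 0) :
    Tendsto (fun k => damp (e k) x) atTop (𝓝 1) := by
  have hx := norm_pos_iff.2 hx
  have h : Tendsto (fun k => ‖x‖ ^ 2 / (‖x‖ ^ 2 + e k)) atTop (𝓝 (‖x‖ ^ 2 / (‖x‖ ^ 2 + 0))) :=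
    tendsto_const_nhds.div (tendsto_const_nhds.add he) (by positivity)
  rwa [add_zero, div_self (by positivity)] at h

theorem tendsto_dampGradient {e : ℕ → ℝ} (he : Tendsto e atTop (𝓝 0))
    (hFB' : ∀ x, ‖F' x‖ ≤ B * ‖x‖⁻¹) (x : E n) :
    Tendsto (fun k => dampGradient (e k) F F' x) atTop (𝓝 (F' x)) := by
  rcases eq_or_ne x 0 with rfl | hx
  -- Since `0⁻¹ = 0`, the bound on `F'` forces its value at the origin to vanish.
  · have h0 : F' 0 = 0 := by simpa using hFB' 0
    simp [dampGradient, h0]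
  have hx' := norm_pos_iff.2 hx
  have h : Tendsto (fun k => 2 * e k / (‖x‖ ^ 2 + e k) ^ 2) atTop
      (𝓝 (2 * 0 / (‖x‖ ^ 2 + 0) ^ 2)) :=
    (he.const_mul 2).div ((tendsto_const_nhds.add he).pow 2) (by positivity)
  have h2 := ((tendsto_damp he hx).smul_const (F' x)).add ((h.const_mul (F x)).smul_const x)
  simpa [dampGradient] using h2

@[fun_prop]
theorem measurable_damp : Measurable (damp ε : E n → ℝ) := by unfold damp; fun_prop

theorem measurable_dampGradient (hF : Measurable F) (hF' : Measurable F') :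
    Measurable (dampGradient ε F F') := by
  unfold dampGradient; fun_prop

end damp

/-- The Gaussian covariance representation for bounded functions whose gradients have a
singularity of order `‖x‖⁻¹` at the origin. -/
theorem gaussian_covariance_of_singular {n : ℕ} (hn : 2 ≤ n) {F G : E n → ℝ} {F' G' : E n → E n}
    {B : ℝ} (hF : ∀ x, x ≠ 0 → HasGradientAt F (F' x) x)
    (hG : ∀ x, x ≠ 0 → HasGradientAt G (G' x) x)
    (hFm : Measurable F) (hGm : Measurable G) (hFm' : Measurable F') (hGm' : Measurable G')
    (hFB : ∀ x, |F x| ≤ B) (hGB : ∀ x, |G x| ≤ B)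
    (hFB' : ∀ x, ‖F' x‖ ≤ B * ‖x‖⁻¹) (hGB' : ∀ x, ‖G' x‖ ≤ B * ‖x‖⁻¹) :
    ∫ p : E n × E n, F p.1 * (G p.1 - G p.2) * gauss2 p =
      ∫ q, Real.sin q.1 * ⟪F' q.2.1, G' (arc q)⟫ * gauss2 q.2 ∂arcMeasure n := by
  have : NeZero n := ⟨by omega⟩
  have hB : 0 ≤ B := (abs_nonneg _).trans (hFB 0)
  set e : ℕ → ℝ := fun k => 1 / ((k : ℝ) + 1) with he
  have hepos : ∀ k, 0 < e k := fun k => by positivity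
  have hetend : Tendsto e atTop (𝓝 0) := tendsto_one_div_add_atTop_nhds_zero_nat
  have hmG := fun k => measurable_dampGradient (ε := e k) hGm hGm'
  have hmF := fun k => measurable_dampGradient (ε := e k) hFm hFm'
  have hdF : ∀ k x, |damp (e k) x * F x| ≤ B := fun k x => by
    rw [abs_mul, abs_of_nonneg (damp_nonneg (hepos k) x)]
    exact (mul_le_of_le_one_left (abs_nonneg _) (damp_le_one (hepos k) x)).trans (hFB x)
  have hdG : ∀ k x, |damp (e k) x * G x| ≤ B := fun k x => by
    rw [abs_mul, abs_of_nonneg (damp_nonneg (hepos k) x)]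
    exact (mul_le_of_le_one_left (abs_nonneg _) (damp_le_one (hepos k) x)).trans (hGB x)
  have key : ∀ k, ∫ p : E n × E n, (damp (e k) p.1 * F p.1) *
      (damp (e k) p.1 * G p.1 - damp (e k) p.2 * G p.2) * gauss2 p =
      ∫ q, Real.sin q.1 * ⟪dampGradient (e k) F F' q.2.1, dampGradient (e k) G G' (arc q)⟫ *
        gauss2 q.2 ∂arcMeasure n := by
    intro k
    have hk := hepos k
    have hb : ∀ x : E n, 3 * B * (‖x‖ / (‖x‖ ^ 2 + e k)) ≤ max B (3 * B * (1 + 1 / e k)) :=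
      fun x => le_max_of_le_right (by gcongr; exact norm_div_norm_sq_add_le hk x)
    exact gaussian_covariance (hasGradientAt_damp_mul hk hF hFB) (hasGradientAt_damp_mul hk hG hGB)
      (hmF k) (hmG k) (fun x => (hdF k x).trans (le_max_left _ _))
      (fun x => (norm_dampGradient_le hk hFB hFB' x).trans (hb x))
      (fun x => (norm_dampGradient_le hk hGB hGB' x).trans (hb x))
  have lim1 : Tendsto (fun k => ∫ p : E n × E n, (damp (e k) p.1 * F p.1) *
      (damp (e k) p.1 * G p.1 - damp (e k) p.2 * G p.2) * gauss2 p) atTop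
      (𝓝 (∫ p : E n × E n, F p.1 * (G p.1 - G p.2) * gauss2 p)) := by
    refine tendsto_integral_of_dominated_convergence (fun p => B * (B + B) * gauss2 p)
      (fun k => by fun_prop) ?_ (fun k => .of_forall fun p => ?_) ?_
    · refine integrable_mul_gauss2 (C := B * (B + B)) measurable_const fun p => ?_
      rw [abs_of_nonneg (by positivity)]
      nlinarith [norm_nonneg p.1, norm_nonneg p.2, mul_nonneg hB hB,
        mul_nonneg (mul_nonneg hB hB) (norm_nonneg p.1),
        mul_nonneg (mul_nonneg hB hB) (norm_nonneg p.2)]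
    · rw [norm_mul, norm_mul, Real.norm_of_nonneg (gauss2_pos p).le]
      refine mul_le_mul_of_nonneg_right (mul_le_mul (hdF k _) ?_ (norm_nonneg _) hB)
        (gauss2_pos p).le
      exact (norm_sub_le _ _).trans (add_le_add (hdG k _) (hdG k _))
    · have h0 : ∀ᵐ x : E n, x ≠ 0 := Measure.ae_ne volume 0
      have h1 : ∀ᵐ p : E n × E n, p.1 ≠ 0 := Measure.quasiMeasurePreserving_fst.ae h0
      have h2 : ∀ᵐ p : E n × E n, p.2 ≠ 0 := Measure.quasiMeasurePreserving_snd.ae h0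
      filter_upwards [h1, h2] with p hp1 hp2
      have t1 := tendsto_damp hetend hp1
      have t2 := tendsto_damp hetend hp2
      simpa using ((t1.mul_const (F p.1)).mul
        ((t1.mul_const (G p.1)).sub (t2.mul_const (G p.2)))).mul_const (gauss2 p)
  have lim2 : Tendsto (fun k => ∫ q, Real.sin q.1 *
      ⟪dampGradient (e k) F F' q.2.1, dampGradient (e k) G G' (arc q)⟫ *
        gauss2 q.2 ∂arcMeasure n) atTop
      (𝓝 (∫ q, Real.sin q.1 * ⟪F' q.2.1, G' (arc q)⟫ * gauss2 q.2 ∂arcMeasure n)) := by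
    refine tendsto_integral_of_dominated_convergence _ (fun k => ?_)
      ((integrable_arc_dominant hn).const_mul ((3 * B) * (3 * B))) (fun k => ?_)
      (.of_forall fun q => ?_)
    · have := hmF k
      have := hmG k
      fun_prop
    · filter_upwards [ae_arcMeasure_sin_pos n] with q hq
      have hk := hepos k
      have hg := gauss2_pos q.2
      rw [norm_mul, norm_mul, Real.norm_of_nonneg hg.le, Real.norm_of_nonneg hq.le]
      have h1 : ∀ (F : E n → ℝ) F' (_ : ∀ x, |F x| ≤ B) (_ : ∀ x, ‖F' x‖ ≤ B * ‖x‖⁻¹) x,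
          ‖dampGradient (e k) F F' x‖ ≤ 3 * B * ‖x‖⁻¹ := fun F F' h h' x =>
        (norm_dampGradient_le hk h h' x).trans
          (by gcongr; exact norm_div_norm_sq_add_le_inv hk x)
      calc _ ≤ Real.sin q.1 * ((3 * B * ‖q.2.1‖⁻¹) * (3 * B * ‖arc q‖⁻¹)) * gauss2 q.2 := by
            gcongr
            refine (norm_inner_le_norm _ _).trans ?_
            gcongr
            exacts [h1 F F' hFB hFB' _, h1 G G' hGB hGB' _]
        _ = _ := by ring
    · exact (((tendsto_dampGradient hetend hFB' _).inner
        (tendsto_dampGradient hetend hGB' _)).const_mul _).mul_const _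
  exact tendsto_nhds_unique lim1 (by simpa only [key] using lim2)

/-! ### Covariance on the sphere. -/

/-- The hypothesis on nonnegative functions says that the image under `Φ` of the measure with
density `ρ` is κν. Equality of measures transfers to real integrals with no integrability condition.
-/
theorem integral_mul_comp_of_lintegral {α β : Type*} [MeasurableSpace α] [MeasurableSpace β]
    {μ : Measure α} {ν : Measure β} {ρ : α → ℝ} {Φ : α → β} {κ : ℝ} (hρ : Measurable ρ)
    (hΦ : Measurable Φ) (hρ0 : ∀ᵐ a ∂μ, 0 ≤ ρ a) (hκ : 0 ≤ κ)
    (h : ∀ k : β → ℝ≥0∞, Measurable k →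
      ∫⁻ a, ENNReal.ofReal (ρ a) * k (Φ a) ∂μ = ENNReal.ofReal κ * ∫⁻ b, k b ∂ν)
    {g : β → ℝ} (hg : Measurable g) :
    ∫ a, ρ a * g (Φ a) ∂μ = κ * ∫ b, g b ∂ν := by
  have hm : (μ.withDensity fun a => ENNReal.ofReal (ρ a)).map Φ = ENNReal.ofReal κ • ν := by
    refine Measure.ext_of_lintegral _ fun k hk => ?_
    rw [lintegral_map hk hΦ, lintegral_smul_measure, smul_eq_mul, ← h k hk,
      lintegral_withDensity_eq_lintegral_mul _ (by fun_prop) (by fun_prop)]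
    rfl
  have h1 := integral_map (μ := μ.withDensity fun a => ENNReal.ofReal (ρ a)) hΦ.aemeasurable
    hg.aestronglyMeasurable
  rw [hm, integral_smul_measure, ENNReal.toReal_ofReal hκ, smul_eq_mul,
    integral_withDensity_eq_integral_toReal_smul (by fun_prop) (by simp)] at h1
  rw [h1]
  refine integral_congr_ae ?_
  filter_upwards [hρ0] with a ha
  rw [ENNReal.toReal_ofReal ha, smul_eq_mul]

/-- The covariance representation on the sphere. -/
theorem sphere_covariance {n : ℕ} (hn : 2 ≤ n) (e : S n) {f g : S n → ℝ} {u v : S n → E n} {B : ℝ}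
    (hf : ∀ x, x ≠ 0 → HasGradientAt (f ∘ radial e) (‖x‖⁻¹ • u (radial e x)) x)
    (hg : ∀ x, x ≠ 0 → HasGradientAt (g ∘ radial e) (‖x‖⁻¹ • v (radial e x)) x)
    (hfm : Measurable f) (hgm : Measurable g) (hum : Measurable u) (hvm : Measurable v)
    (hfB : ∀ x, |f x| ≤ B) (hgB : ∀ x, |g x| ≤ B) (huB : ∀ x, ‖u x‖ ≤ B) (hvB : ∀ x, ‖v x‖ ≤ B) :
    ∫ x, f x * g x ∂sigma n - (∫ x, f x ∂sigma n) * ∫ x, g x ∂sigma n =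
      ∫ p, ⟪u p.1, v p.2⟫ ∂nu n := by
  have hB : 0 ≤ B := (abs_nonneg _).trans (hfB e)
  have bd : ∀ w : S n → E n, (∀ x, ‖w x‖ ≤ B) → ∀ x : E n,
      ‖‖x‖⁻¹ • w (radial e x)‖ ≤ B * ‖x‖⁻¹ := by
    intro w hw x
    rw [norm_smul, norm_inv, norm_norm, mul_comm]
    gcongr
    exact hw _
  have key := gaussian_covariance_of_singular hn hf hg (by fun_prop) (by fun_prop)
    (by fun_prop) (by fun_prop) (fun x => hfB _) (fun x => hgB _) (bd u huB) (bd v hvB)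
  have hgauss : ∀ k : S n → ℝ, Measurable k → ∫ x : E n, rexp (-(‖x‖ ^ 2 / 2)) * k (radial e x) =
      (2 * π) ^ ((n : ℝ) / 2) * ∫ x, k x ∂sigma n := fun k hk =>
    integral_mul_comp_of_lintegral (by fun_prop) (by fun_prop)
      (.of_forall fun x => (exp_pos _).le) (by positivity)
      (fun k hk => lintegral_gaussian_radial (by omega) e hk) hk
  have hgint : ∀ k : S n → ℝ, Measurable k → (∃ C, ∀ x, |k x| ≤ C) →
      Integrable fun x : E n => rexp (-(‖x‖ ^ 2 / 2)) * k (radial e x) := by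
    rintro k hk ⟨C, hC⟩
    exact (integrable_gaussian n).mul_bdd (c := C)
      (hk.comp (measurable_radial e)).aestronglyMeasurable (.of_forall fun x => hC _)
  have hrhs := integral_mul_comp_of_lintegral (μ := arcMeasure n) (ν := nu n)
    (ρ := fun q => Real.sin q.1 * (‖q.2.1‖⁻¹ * ‖arc q‖⁻¹) * gauss2 q.2)
    (Φ := fun q => (radial e q.2.1, radial e (arc q))) (κ := (2 * π) ^ n)
    (by fun_prop) (by fun_prop)
    (by filter_upwards [ae_arcMeasure_sin_pos n] with q hq
        have := gauss2_pos q.2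
        positivity) (by positivity) (fun k hk => lintegral_arcMeasure hn e hk)
    (g := fun p => ⟪u p.1, v p.2⟫) (by fun_prop)
  -- The two factors |x|⁻¹ from the gradients of the extensions, together with sin θ and the
  -- Gaussian density, form exactly the weight whose directional law is `nu`.
  have e1 : ∫ q, Real.sin q.1 * ⟪‖q.2.1‖⁻¹ • u (radial e q.2.1),
      ‖arc q‖⁻¹ • v (radial e (arc q))⟫ * gauss2 q.2 ∂arcMeasure n =
      (2 * π) ^ n * ∫ p, ⟪u p.1, v p.2⟫ ∂nu n := by
    rw [← hrhs]
    refine integral_congr_ae (.of_forall fun q => ?_)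
    simp only [real_inner_smul_left, real_inner_smul_right]
    ring
  rw [e1] at key
  have hprod : ∀ k l : S n → ℝ, Measurable k → Measurable l →
      ∫ p : E n × E n, (rexp (-(‖p.1‖ ^ 2 / 2)) * k (radial e p.1)) *
        (rexp (-(‖p.2‖ ^ 2 / 2)) * l (radial e p.2)) =
      (2 * π) ^ n * ((∫ x, k x ∂sigma n) * ∫ x, l x ∂sigma n) := by
    intro k l hk hl
    rw [Measure.volume_eq_prod, integral_prod_mul (fun x => rexp (-(‖x‖ ^ 2 / 2)) * k (radial e x))
      (fun x => rexp (-(‖x‖ ^ 2 / 2)) * l (radial e x)), hgauss k hk, hgauss l hl,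
      mul_mul_mul_comm, ← Real.rpow_add (by positivity), add_halves, Real.rpow_natCast]
  have hsub : ∫ p : E n × E n, (f ∘ radial e) p.1 * ((g ∘ radial e) p.1 - (g ∘ radial e) p.2) *
      gauss2 p = (2 * π) ^ n * (∫ x, f x * g x ∂sigma n -
        (∫ x, f x ∂sigma n) * ∫ x, g x ∂sigma n) := by
    have := isProbabilityMeasure_sigma (n := n) (by omega)
    have e2 := hprod (fun x => f x * g x) (fun _ => 1) (by fun_prop) (by fun_prop)
    have e3 := hprod f g hfm hgm
    rw [integral_const, probReal_univ, one_smul, mul_one] at e2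
    rw [mul_sub, ← e2, ← e3, ← integral_sub]
    · refine integral_congr_ae (.of_forall fun p => ?_)
      simp only [Function.comp, gauss2_eq_mul]
      ring
    · exact (hgint (fun x => f x * g x) (by fun_prop) ⟨B * B, fun x => by
        rw [abs_mul]
        exact mul_le_mul (hfB x) (hgB x) (abs_nonneg _) hB⟩).mul_prod
          (hgint (fun _ => 1) (by fun_prop) ⟨1, fun x => by simp⟩)
    · exact (hgint f hfm ⟨B, hfB⟩).mul_prod (hgint g hgm ⟨B, hgB⟩)
  rw [hsub] at key
  exact mul_left_cancel₀ (by positivity) key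

/-! ### The spherical gradient as the gradient of the extension constant on rays. -/

/-- Radial projection is a smooth map from the punctured space to the sphere; composing with it
turns the manifold notion of C¹ into ordinary calculus. -/
theorem contDiffAt_comp_radial {d : ℕ} {f : S (d + 1) → ℝ} (hf : ContMDiff (𝓡 d) 𝓘(ℝ, ℝ) 1 f)
    (e : S (d + 1)) {x : E (d + 1)} (hx : x ≠ 0) : ContDiffAt ℝ 1 (f ∘ radial e) x := by
  let U : TopologicalSpace.Opens (E (d + 1)) := ⟨{0}ᶜ, isOpen_compl_singleton⟩
  have h1 : ContMDiff 𝓘(ℝ, E (d + 1)) 𝓘(ℝ, E (d + 1)) 1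
      (fun y : U => ‖(y : E (d + 1))‖⁻¹ • (y : E (d + 1))) := by
    intro y
    have hy : (y : E (d + 1)) ≠ 0 := y.2
    refine (contMDiffAt_subtype_iff (U := U) (x := y)
      (f := fun y : E (d + 1) => ‖y‖⁻¹ • y)).2 ?_
    rw [contMDiffAt_iff_contDiffAt]
    exact ((contDiffAt_norm ℝ hy).inv (norm_ne_zero_iff.2 hy)).smul contDiffAt_id
  have hmem : ∀ y : U, ‖(y : E (d + 1))‖⁻¹ • (y : E (d + 1)) ∈ sphere (0 : E (d + 1)) 1 := by
    intro y
    have : ‖(y : E (d + 1))‖ ≠ 0 := norm_ne_zero_iff.2 y.2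
    simp [norm_smul, this]
  have h2 : ContMDiff 𝓘(ℝ, E (d + 1)) (𝓡 d) 1 (Set.codRestrict _ _ hmem) :=
    have : Fact (Module.finrank ℝ (E (d + 1)) = d + 1) := ⟨finrank_euclideanSpace_fin⟩
    h1.codRestrict_sphere hmem
  have h3 := (hf.comp h2) ⟨x, hx⟩
  have h4 := (contMDiffAt_subtype_iff (U := U) (x := ⟨x, hx⟩) (f := f ∘ radial e)
    (I := 𝓘(ℝ, E (d + 1))) (I' := 𝓘(ℝ, ℝ)) (n := 1)).1 (by
      refine h3.congr_of_eventuallyEq (.of_forall fun y => ?_)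
      simp only [Function.comp]
      congr 1
      ext1
      exact coe_radial e y.2)
  exact contMDiffAt_iff_contDiffAt.1 h4

section gradient

variable {n : ℕ} {f : S n → ℝ} {e : S n}

theorem gradient_comp_radial_smul
    (hF : ∀ x, x ≠ 0 → DifferentiableAt ℝ (f ∘ radial e) x) {r : ℝ} (hr : 0 < r) {x : E n}
    (hx : x ≠ 0) : gradient (f ∘ radial e) (r • x) = r⁻¹ • gradient (f ∘ radial e) x := by
  have h1 := (hF (r • x) (smul_ne_zero hr.ne' hx)).hasGradientAt.hasFDerivAt.comp x
    ((hasFDerivAt_id x).const_smul r)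
  have h2 : (f ∘ radial e) ∘ (r • ·) = f ∘ radial e := by
    ext y
    simp [radial_smul e hr]
  change HasFDerivAt ((f ∘ radial e) ∘ (r • ·)) _ x at h1
  rw [h2] at h1
  have h3 : HasGradientAt (f ∘ radial e) (r • gradient (f ∘ radial e) (r • x)) x := by
    rw [hasGradientAt_iff_hasFDerivAt]
    refine h1.congr_fderiv ?_
    ext y
    simp
  rw [h3.gradient, smul_smul, inv_mul_cancel₀ hr.ne', one_smul]

/-- The extension is constant on rays, so its radial derivative vanishes. -/
theorem inner_gradient_comp_radial (hF : ∀ x, x ≠ 0 → DifferentiableAt ℝ (f ∘ radial e) x)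
    (ξ : S n) : ⟪gradient (f ∘ radial e) (ξ : E n), (ξ : E n)⟫ = 0 := by
  have h1 : HasDerivAt (fun t : ℝ => (ξ : E n) + t • (ξ : E n)) (ξ : E n) 0 := by
    simpa using ((hasDerivAt_id (0 : ℝ)).smul_const (ξ : E n)).const_add (ξ : E n)
  have h2 := (hF ξ (coe_ne_zero ξ)).hasGradientAt.hasFDerivAt
  have h3 := HasFDerivAt.comp_hasDerivAt_of_eq (0 : ℝ) h2 h1 (by simp)
  have h4 : HasDerivAt ((f ∘ radial e) ∘ fun t : ℝ => (ξ : E n) + t • (ξ : E n)) 0 0 := by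
    refine (hasDerivAt_const (0 : ℝ) (f ξ)).congr_of_eventuallyEq ?_
    filter_upwards [lt_mem_nhds (show (-1 : ℝ) < 0 by norm_num)] with t ht
    have h5 : (ξ : E n) + t • (ξ : E n) = (1 + t) • (ξ : E n) := by module
    simp only [Function.comp]
    rw [h5, radial_smul_coe e (by linarith)]
  simpa using h3.unique h4

/-- Let w be the ambient gradient, which is tangent at ξ. The curve obtained by projecting ξ + t w
to the sphere has velocity w at 0, so any competitor w' must give the same derivative of f along it:
⟨w', w⟩ = |w|². Cauchy-Schwarz then yields |w| ≤ |w'|. -/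
theorem isSphereGradient_gradient (hF : ∀ x, x ≠ 0 → DifferentiableAt ℝ (f ∘ radial e) x)
    (ξ : S n) : IsSphereGradient f ξ (gradient (f ∘ radial e) (ξ : E n)) := by
  have hg := (hF ξ (coe_ne_zero ξ)).hasGradientAt
  have horth := inner_gradient_comp_radial hF ξ
  set w := gradient (f ∘ radial e) (ξ : E n)
  refine ⟨?_, fun w' hw' => ?_⟩
  · have h1 := hg.hasFDerivAt.isLittleO.comp_tendsto (continuous_subtype_val.tendsto ξ)
    refine h1.congr_left fun x' => ?_
    simp [Function.comp, radial_coe]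
  · have hpos : ∀ t : ℝ, 0 < 1 + t ^ 2 * ‖w‖ ^ 2 := fun t => by positivity
    have hnorm : ∀ t : ℝ, ‖(ξ : E n) + t • w‖ = √(1 + t ^ 2 * ‖w‖ ^ 2) := fun t => by
      rw [← Real.sqrt_sq (norm_nonneg ((ξ : E n) + t • w)), norm_add_sq_real, norm_coe,
        inner_smul_right, real_inner_comm, horth, norm_smul, mul_pow, Real.norm_eq_abs, sq_abs]
      simp
    have hne : ∀ t : ℝ, (ξ : E n) + t • w ≠ 0 := fun t => by
      rw [← norm_ne_zero_iff, hnorm]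
      exact (Real.sqrt_pos.2 (hpos t)).ne'
    set γ : ℝ → S n := fun t => radial e ((ξ : E n) + t • w) with hγ
    have hγc : ∀ t, (γ t : E n) = (√(1 + t ^ 2 * ‖w‖ ^ 2))⁻¹ • ((ξ : E n) + t • w) := fun t => by
      rw [hγ, coe_radial e (hne t), hnorm]
    have hγ0 : γ 0 = ξ := by simp [hγ, radial_coe]
    have hline : HasDerivAt (fun t : ℝ => (ξ : E n) + t • w) w 0 := by
      simpa using ((hasDerivAt_id (0 : ℝ)).smul_const w).const_add (ξ : E n)
    have hderiv : HasDerivAt (fun t => (γ t : E n)) w 0 := by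
      have h1 : HasDerivAt (fun t : ℝ => 1 + t ^ 2 * ‖w‖ ^ 2) 0 0 := by
        simpa using ((hasDerivAt_pow 2 (0 : ℝ)).mul_const (‖w‖ ^ 2)).const_add 1
      have h2 := ((h1.sqrt (hpos 0).ne').inv (Real.sqrt_pos.2 (hpos 0)).ne').smul hline
      have h3 : (fun t => (γ t : E n)) =
          fun t : ℝ => (√(1 + t ^ 2 * ‖w‖ ^ 2))⁻¹ • ((ξ : E n) + t • w) := funext hγc
      rw [h3]
      refine h2.congr_deriv ?_
      simp
    have htend : Tendsto γ (𝓝 0) (𝓝 ξ) := by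
      rw [tendsto_subtype_rng, ← hγ0]
      exact hderiv.continuousAt
    have h1 : (fun t => f (γ t) - f ξ - ⟪w', (γ t : E n) - (ξ : E n)⟫) =o[𝓝 0]
        fun t : ℝ => t := by
      refine (hw'.comp_tendsto htend).trans_isBigO ?_
      simpa [hγ0, Function.comp_def] using hderiv.isBigO_sub
    have h2 : HasDerivAt (fun t => f (γ t) - f ξ - ⟪w', (γ t : E n) - (ξ : E n)⟫) 0 0 := by
      rw [hasDerivAt_iff_isLittleO_nhds_zero]
      simpa [hγ0] using h1
    have h3 : HasDerivAt (fun t => ⟪w', (γ t : E n) - (ξ : E n)⟫) ⟪w', w⟫ 0 := by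
      simpa using (hasDerivAt_const (0 : ℝ) w').inner ℝ (hderiv.sub_const (ξ : E n))
    have h4 : HasDerivAt (fun t => f (γ t) - f ξ) ⟪w', w⟫ 0 := by
      simpa [Pi.add_def] using h2.add h3
    have h5 := (HasFDerivAt.comp_hasDerivAt_of_eq (0 : ℝ) hg.hasFDerivAt hline
      (by simp)).sub_const (f ξ)
    have h6 := h5.unique h4
    simp only [InnerProductSpace.toDual_apply_apply, real_inner_self_eq_norm_sq] at h6
    have h7 := real_inner_le_norm w' w
    by_contra hlt
    push Not at hlt
    nlinarith [norm_nonneg w', norm_nonneg w]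

theorem sphereGradient_eq (hF : ∀ x, x ≠ 0 → DifferentiableAt ℝ (f ∘ radial e) x) (ξ : S n) :
    sphereGradient f ξ = gradient (f ∘ radial e) (ξ : E n) := by
  have h : ∃ w, IsSphereGradient f ξ w := ⟨_, isSphereGradient_gradient hF ξ⟩
  rw [sphereGradient, dif_pos h]
  exact h.choose_spec.unique (isSphereGradient_gradient hF ξ)

theorem hasGradientAt_comp_radial (hF : ∀ x, x ≠ 0 → DifferentiableAt ℝ (f ∘ radial e) x)
    {x : E n} (hx : x ≠ 0) :
    HasGradientAt (f ∘ radial e) (‖x‖⁻¹ • sphereGradient f (radial e x)) x := by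
  have h := (hF x hx).hasGradientAt
  have hx' := norm_pos_iff.2 hx
  rwa [sphereGradient_eq hF, coe_radial e hx, gradient_comp_radial_smul hF (by positivity) hx,
    smul_smul, inv_inv, inv_mul_cancel₀ hx'.ne', one_smul]

end gradient

theorem continuous_sphereGradient {d : ℕ} {f : S (d + 1) → ℝ}
    (hf : ContMDiff (𝓡 d) 𝓘(ℝ, ℝ) 1 f) : Continuous (sphereGradient f) := by
  have e : S (d + 1) := ⟨EuclideanSpace.single 0 1, by simp⟩
  have hd := fun x (hx : x ≠ 0) => contDiffAt_comp_radial hf e (x := x) hx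
  have h1 : ContDiffOn ℝ 1 (f ∘ radial e) {0}ᶜ := fun x hx => (hd x hx).contDiffWithinAt
  have h2 := h1.continuousOn_fderiv_of_isOpen isOpen_compl_singleton le_rfl
  have h3 : sphereGradient f = fun ξ : S (d + 1) => gradient (f ∘ radial e) (ξ : E (d + 1)) :=
    funext (sphereGradient_eq fun x hx => (hd x hx).differentiableAt one_ne_zero)
  rw [h3]
  have h4 : Continuous fun ξ : S (d + 1) => fderiv ℝ (f ∘ radial e) (ξ : E (d + 1)) :=
    h2.comp_continuous continuous_subtype_val coe_ne_zero
  exact (InnerProductSpace.toDual ℝ (E (d + 1))).symm.continuous.comp h4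

/-! ### Rotation invariance and the marginals of `mu`. -/

/-- The action of a linear isometry of the ambient space on the sphere. -/
def sphereMap {n : ℕ} (R : E n ≃ₗᵢ[ℝ] E n) (x : S n) : S n := ⟨R x, by simp⟩

@[fun_prop]
theorem measurable_sphereMap {n : ℕ} (R : E n ≃ₗᵢ[ℝ] E n) : Measurable (sphereMap R) :=
  Measurable.subtype_mk (R.continuous.measurable.comp measurable_subtype_coe)

theorem radial_map {n : ℕ} (R : E n ≃ₗᵢ[ℝ] E n) (e : S n) {x : E n} (hx : x ≠ 0) :
    radial e (R x) = sphereMap R (radial e x) := by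
  ext1
  rw [coe_radial e (by simpa using hx)]
  simp [sphereMap, coe_radial e hx]

/-- Invariance of the uniform distribution is read off from that of the Gaussian measure, whose
direction it is. -/
theorem lintegral_sigma_comp_sphereMap {n : ℕ} (hn : 1 ≤ n) (R : E n ≃ₗᵢ[ℝ] E n)
    {h : S n → ℝ≥0∞} (hh : Measurable h) :
    ∫⁻ x, h (sphereMap R x) ∂sigma n = ∫⁻ x, h x ∂sigma n := by
  have : NeZero n := ⟨by omega⟩
  have e : S n := ⟨EuclideanSpace.single 0 1, by simp⟩
  have h1 := lintegral_gaussian_radial hn e hh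
  rw [← R.measurePreserving.lintegral_comp (by fun_prop)] at h1
  have h2 := lintegral_gaussian_radial hn e (hh.comp (measurable_sphereMap R))
  have h3 : ∫⁻ x : E n, ENNReal.ofReal (rexp (-(‖R x‖ ^ 2 / 2))) * h (radial e (R x)) =
      ∫⁻ x : E n, ENNReal.ofReal (rexp (-(‖x‖ ^ 2 / 2))) * (h ∘ sphereMap R) (radial e x) := by
    refine lintegral_congr_ae ?_
    filter_upwards [Measure.ae_ne volume (0 : E n)] with x hx
    rw [radial_map R e hx, R.norm_map, Function.comp]
  rw [h3, h2] at h1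
  exact (ENNReal.mul_right_inj (ENNReal.ofReal_pos.2 (by positivity)).ne'
    ENNReal.ofReal_ne_top).1 h1

/-- The reflection in the hyperplane orthogonal to y - z carries y to z and preserves both `sigma`
and inner products. -/
theorem lintegral_psi_inner {n : ℕ} (hn : 1 ≤ n) (y z : S n) :
    ∫⁻ x : S n, psi n ⟪(x : E n), (y : E n)⟫ ∂sigma n =
      ∫⁻ x : S n, psi n ⟪(x : E n), (z : E n)⟫ ∂sigma n := by
  have hR := Submodule.reflection_sub (v := (y : E n)) (w := (z : E n)) (by simp)
  set R := (ℝ ∙ ((y : E n) - (z : E n)))ᗮ.reflection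
  rw [← lintegral_sigma_comp_sphereMap hn R
    (h := fun x : S n => psi n ⟪(x : E n), (z : E n)⟫) (by fun_prop)]
  simp_rw [← hR, sphereMap, LinearIsometryEquiv.inner_map_map]

/-- Integrating the density over the first point gives a number independent of the second, so the
second marginal is a multiple of `sigma`; the test function 1 identifies the multiple. -/
theorem lintegral_nu_snd {n : ℕ} (hn : 1 ≤ n) {h : S n → ℝ≥0∞} (hh : Measurable h) :
    ∫⁻ p, h p.2 ∂nu n = nu n univ * ∫⁻ x, h x ∂sigma n := by
  have : NeZero n := ⟨by omega⟩
  have e : S n := ⟨EuclideanSpace.single 0 1, by simp⟩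
  have hσ := isProbabilityMeasure_sigma hn
  have key : ∀ h : S n → ℝ≥0∞, Measurable h → ∫⁻ p, h p.2 ∂nu n =
      (∫⁻ x : S n, psi n ⟪(x : E n), (e : E n)⟫ ∂sigma n) * ∫⁻ x, h x ∂sigma n := by
    intro h hh
    rw [nu, lintegral_withDensity_eq_lintegral_mul _ (by fun_prop) (by fun_prop)]
    simp only [Pi.mul_apply]
    rw [lintegral_prod_symm _ (by fun_prop), ← lintegral_const_mul _ hh]
    refine lintegral_congr fun y => ?_
    simp only
    rw [lintegral_mul_const _ (by fun_prop), lintegral_psi_inner hn y e]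
  have h1 := key (fun _ => 1) measurable_const
  simp only [lintegral_const, one_mul, measure_univ, mul_one] at h1
  rw [key h hh, h1]

theorem map_swap_nu {n : ℕ} (hn : 1 ≤ n) : (nu n).map Prod.swap = nu n := by
  have hσ := isProbabilityMeasure_sigma hn
  refine Measure.ext_of_lintegral _ fun k hk => ?_
  rw [lintegral_map hk measurable_swap, nu,
    lintegral_withDensity_eq_lintegral_mul _ (by fun_prop) (by fun_prop),
    lintegral_withDensity_eq_lintegral_mul _ (by fun_prop) hk]
  rw [← lintegral_prod_swap]
  refine lintegral_congr fun p => ?_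
  simp [real_inner_comm]

theorem setLIntegral_ne_zero_of_forall {α : Type*} [MeasurableSpace α] {μ : Measure α} {s : Set α}
    {f : α → ℝ≥0∞} (hf : Measurable f) (hs : μ s ≠ 0) (h : ∀ x ∈ s, f x ≠ 0) :
    ∫⁻ x in s, f x ∂μ ≠ 0 := by
  refine ((setLIntegral_pos_iff hf).2 ?_).ne'
  have h1 : s ⊆ Function.support f := h
  rw [inter_eq_right.2 h1]
  exact pos_iff_ne_zero.2 hs

theorem psi_ne_zero {n : ℕ} (hn : 2 ≤ n) (α : ℝ) : psi n α ≠ 0 := by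
  have hn' : (0 : ℝ) < n := by exact_mod_cast (by omega : 0 < n)
  have hG := Real.Gamma_pos_of_pos (half_pos hn')
  rw [psi_eq]
  refine mul_ne_zero (ENNReal.ofReal_pos.2 (by positivity)).ne' ?_
  refine setLIntegral_ne_zero_of_forall (by fun_prop) (by simp) fun t ht => mul_ne_zero ?_ ?_
  · have : 0 < 1 - t ^ 2 := by nlinarith [ht.1, ht.2]
    exact (ENNReal.ofReal_pos.2 (by positivity)).ne'
  · rw [radialIntegral]
    refine setLIntegral_ne_zero_of_forall (Measurable.lintegral_prod_right (by fun_prop)) (by simp)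
      fun r hr => setLIntegral_ne_zero_of_forall (by fun_prop) (by simp) fun r' hr' => ?_
    have hr : 0 < r := hr
    have hr' : 0 < r' := hr'
    exact (ENNReal.ofReal_pos.2 (by positivity)).ne'

theorem nu_univ_ne_zero {n : ℕ} (hn : 2 ≤ n) : nu n univ ≠ 0 := by
  have hσ := isProbabilityMeasure_sigma (n := n) (by omega)
  rw [nu, withDensity_apply _ .univ, Measure.restrict_univ]
  have := setLIntegral_ne_zero_of_forall (μ := (sigma n).prod (sigma n)) (s := univ)
    (f := fun p => psi n ⟪(p.1 : E n), (p.2 : E n)⟫) (by fun_prop) (by simp)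
    (fun p _ => psi_ne_zero hn _)
  rwa [Measure.restrict_univ] at this

theorem isProbabilityMeasure_mu {n : ℕ} (hn : 2 ≤ n) : IsProbabilityMeasure (mu n) :=
  ⟨by rw [mu, Measure.smul_apply, smul_eq_mul,
    ENNReal.inv_mul_cancel (nu_univ_ne_zero hn) (nu_univ_ne_top hn)]⟩

theorem measurePreserving_snd_mu {n : ℕ} (hn : 2 ≤ n) :
    MeasurePreserving Prod.snd (mu n) (sigma n) := by
  refine ⟨measurable_snd, Measure.ext_of_lintegral _ fun k hk => ?_⟩
  rw [lintegral_map hk measurable_snd, mu, lintegral_smul_measure, smul_eq_mul,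
    lintegral_nu_snd (by omega) hk, ← mul_assoc,
    ENNReal.inv_mul_cancel (nu_univ_ne_zero hn) (nu_univ_ne_top hn), one_mul]

theorem measurePreserving_fst_mu {n : ℕ} (hn : 2 ≤ n) :
    MeasurePreserving Prod.fst (mu n) (sigma n) := by
  have h : MeasurePreserving Prod.swap (mu n) (mu n) :=
    ⟨measurable_swap, by rw [mu, Measure.map_smul, map_swap_nu (by omega)]⟩
  exact (measurePreserving_snd_mu hn).comp h

theorem integral_nu {n : ℕ} (hn : 2 ≤ n) (k : S n × S n → ℝ) :
    ∫ p, k p ∂nu n = c n * ∫ p, k p ∂mu n := by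
  rw [mu, integral_smul_measure, c, measureReal_def, ENNReal.toReal_inv, smul_eq_mul,
    mul_inv_cancel_left₀ (ENNReal.toReal_ne_zero.2 ⟨nu_univ_ne_zero hn, nu_univ_ne_top hn⟩)]

/-! ### Entropy and exponential integrals. -/

/-- A consequence of the variational formula for entropy. -/
theorem integral_exp_le_of_integral_mul_exp_le {α : Type*} [MeasurableSpace α] {μ : Measure α}
    [IsProbabilityMeasure μ] {φ U : α → ℝ} (hφ : Integrable (fun x => rexp (φ x)) μ)
    (hφφ : Integrable (fun x => φ x * rexp (φ x)) μ) (hU : Integrable (fun x => rexp (U x)) μ)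
    (hUφ : Integrable (fun x => U x * rexp (φ x)) μ)
    (h : ∫ x, φ x * rexp (φ x) ∂μ ≤ ∫ x, U x * rexp (φ x) ∂μ) :
    ∫ x, rexp (φ x) ∂μ ≤ ∫ x, rexp (U x) ∂μ := by
  have hL := integral_exp_pos hφ
  have hK := integral_exp_pos hU
  set L := ∫ x, rexp (φ x) ∂μ with hLdef
  set K := ∫ x, rexp (U x) ∂μ with hKdef
  -- This is 1 + u ≤ e^u at u = U - φ + log(L/K), multiplied by e^φ. The shift makes the right side
  -- integrate to L, so that integration and the hypothesis leave (log L - log K) L ≤ 0.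
  have hpt : ∀ x, U x * rexp (φ x) - φ x * rexp (φ x) + (Real.log L - Real.log K + 1) *
      rexp (φ x) ≤ L / K * rexp (U x) := by
    intro x
    have h1 := Real.add_one_le_exp (U x - φ x + (Real.log L - Real.log K))
    have h2 : rexp (φ x) * rexp (U x - φ x + (Real.log L - Real.log K)) = L / K * rexp (U x) := by
      rw [← Real.exp_add, ← Real.log_div hL.ne' hK.ne', show φ x + (U x - φ x + Real.log (L / K)) =
        Real.log (L / K) + U x by ring, Real.exp_add, Real.exp_log (by positivity)]
    rw [← h2]
    nlinarith [mul_le_mul_of_nonneg_left h1 (exp_pos (φ x)).le]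
  have hint := integral_mono (((hUφ.sub hφφ).add (hφ.const_mul (Real.log L - Real.log K + 1))))
    (hU.const_mul (L / K)) hpt
  rw [integral_const_mul, ← hKdef, div_mul_cancel₀ _ hK.ne'] at hint
  have h3 : ∫ x, (((fun x => U x * rexp (φ x)) - fun x => φ x * rexp (φ x)) +
      fun x => (Real.log L - Real.log K + 1) * rexp (φ x)) x ∂μ =
      ∫ x, U x * rexp (φ x) ∂μ - ∫ x, φ x * rexp (φ x) ∂μ +
        (Real.log L - Real.log K + 1) * L := by
    rw [integral_add' (hUφ.sub hφφ) (hφ.const_mul _), integral_sub' hUφ hφφ, integral_const_mul]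
  rw [h3] at hint
  have h4 : (Real.log L - Real.log K) * L ≤ 0 := by nlinarith
  have h5 : Real.log L ≤ Real.log K := by
    by_contra hlt
    push Not at hlt
    nlinarith [mul_pos (sub_pos.2 hlt) hL]
  exact (Real.log_le_log_iff hL hK).1 h5

theorem integrable_of_continuous {X : Type*} [TopologicalSpace X] [CompactSpace X] [T2Space X]
    [MeasurableSpace X] [OpensMeasurableSpace X] {μ : Measure X} [IsFiniteMeasure μ]
    {k : X → ℝ} (hk : Continuous k) : Integrable k μ := by
  have := hk.continuousOn.integrableOn_compact (μ := μ) isCompact_univ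
  rwa [integrableOn_univ] at this

/-- The covariance identity for the pair f, e^f: the gradient of e^f is e^f ∇_S f, and the product
of the means vanishes because f has mean zero. -/
theorem integral_mul_exp_eq {d : ℕ} (hd : 1 ≤ d) {f : S (d + 1) → ℝ}
    (hf : ContMDiff (𝓡 d) 𝓘(ℝ, ℝ) 1 f) (hmean : ∫ x, f x ∂sigma (d + 1) = 0) :
    ∫ x, f x * rexp (f x) ∂sigma (d + 1) =
      ∫ p, c (d + 1) * ⟪sphereGradient f p.1, sphereGradient f p.2⟫ * rexp (f p.2)
        ∂mu (d + 1) := by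
  have e : S (d + 1) := ⟨EuclideanSpace.single 0 1, by simp⟩
  have hfc : Continuous f := hf.continuous
  have huc := continuous_sphereGradient hf
  have hF := fun x (hx : x ≠ 0) =>
    (contDiffAt_comp_radial hf e (x := x) hx).differentiableAt one_ne_zero
  have hexp : ∀ x, x ≠ 0 → HasGradientAt ((fun y => rexp (f y)) ∘ radial e)
      (‖x‖⁻¹ • (fun y => rexp (f y) • sphereGradient f y) (radial e x)) x := by
    intro x hx
    have h1 := (hasGradientAt_comp_radial hF hx).hasFDerivAt.exp
    rw [hasGradientAt_iff_hasFDerivAt]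
    refine h1.congr_fderiv ?_
    simp only [Function.comp, map_smul]
    rw [smul_comm]
  have bdd : ∀ k : S (d + 1) → ℝ, Continuous k → ∃ B, ∀ x, k x ≤ B := fun k hk => by
    obtain ⟨B, hB⟩ := isCompact_univ.bddAbove_image hk.continuousOn
    exact ⟨B, fun x => hB ⟨x, mem_univ _, rfl⟩⟩
  have hgc : Continuous fun y => rexp (f y) • sphereGradient f y := by fun_prop
  obtain ⟨B₁, h₁⟩ := bdd (fun x => |f x|) (by fun_prop)
  obtain ⟨B₂, h₂⟩ := bdd (fun x => |rexp (f x)|) (by fun_prop)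
  obtain ⟨B₃, h₃⟩ := bdd (fun x => ‖sphereGradient f x‖) (by fun_prop)
  obtain ⟨B₄, h₄⟩ := bdd (fun x => ‖rexp (f x) • sphereGradient f x‖) hgc.norm
  have key := sphere_covariance (n := d + 1) (by omega) e
    (f := f) (g := fun y => rexp (f y)) (u := sphereGradient f)
    (v := fun y => rexp (f y) • sphereGradient f y) (B := max (max B₁ B₂) (max B₃ B₄))
    (fun x hx => hasGradientAt_comp_radial hF hx) hexp hfc.measurable
    (by fun_prop) huc.measurable hgc.measurable
    (fun x => (h₁ x).trans (by simp)) (fun x => (h₂ x).trans (by simp))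
    (fun x => (h₃ x).trans (by simp)) (fun x => (h₄ x).trans (by simp))
  rw [hmean, zero_mul, sub_zero, integral_nu (by omega), ← integral_const_mul] at key
  rw [key]
  refine integral_congr_ae (.of_forall fun p => ?_)
  simp only [real_inner_smul_right]
  ring

end SphereCov

end

/-! ### The two exponential inequalities. -/

theorem corollary11p2 (d : ℕ) (hd : 1 ≤ d) (f : SphereCov.S (d + 1) → ℝ)
    (hf : ContMDiff (𝓡 d) 𝓘(ℝ, ℝ) 1 f)
    (hmean : ∫ x, f x ∂(SphereCov.sigma (d + 1)) = 0) :
    (∫ x, Real.exp (f x) ∂(SphereCov.sigma (d + 1)) ≤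
      ∫ p, Real.exp (SphereCov.c (d + 1) *
        ⟪SphereCov.sphereGradient f p.1, SphereCov.sphereGradient f p.2⟫)
          ∂(SphereCov.mu (d + 1))) ∧
    (∫ x, Real.exp (f x) ∂(SphereCov.sigma (d + 1)) ≤
      ∫ x, Real.exp (SphereCov.c (d + 1) * ‖SphereCov.sphereGradient f x‖ ^ 2)
          ∂(SphereCov.sigma (d + 1))) := by
  have hn : 2 ≤ d + 1 := by omega
  have := SphereCov.isProbabilityMeasure_mu hn
  have := SphereCov.isProbabilityMeasure_sigma (n := d + 1) (by omega)
  have hfc : Continuous f := hf.continuous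
  have huc := SphereCov.continuous_sphereGradient hf
  have hsnd := SphereCov.measurePreserving_snd_mu hn
  have hfst := SphereCov.measurePreserving_fst_mu hn
  have int_snd : ∀ k : SphereCov.S (d + 1) → ℝ, Continuous k →
      ∫ p, k p.2 ∂(SphereCov.mu (d + 1)) = ∫ x, k x ∂(SphereCov.sigma (d + 1)) := fun k hk => by
    rw [← hsnd.map_eq, integral_map hsnd.measurable.aemeasurable hk.aestronglyMeasurable]
  have int_fst : ∀ k : SphereCov.S (d + 1) → ℝ, Continuous k →
      ∫ p, k p.1 ∂(SphereCov.mu (d + 1)) = ∫ x, k x ∂(SphereCov.sigma (d + 1)) := fun k hk => by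
    rw [← hfst.map_eq, integral_map hfst.measurable.aemeasurable hk.aestronglyMeasurable]
  have first : ∫ x, Real.exp (f x) ∂(SphereCov.sigma (d + 1)) ≤
      ∫ p, Real.exp (SphereCov.c (d + 1) *
        ⟪SphereCov.sphereGradient f p.1, SphereCov.sphereGradient f p.2⟫)
          ∂(SphereCov.mu (d + 1)) := by
    -- The left side is lifted to `mu` through the second marginal, because e^f sits at the second
    -- point in the covariance identity; the entropy comparison then has φ(x, y) = f(y).
    rw [← int_snd (fun x => Real.exp (f x)) (by fun_prop)]
    refine SphereCov.integral_exp_le_of_integral_mul_exp_le (μ := SphereCov.mu (d + 1))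
      (φ := fun p => f p.2)
      (SphereCov.integrable_of_continuous (by fun_prop))
      (SphereCov.integrable_of_continuous (by fun_prop))
      (SphereCov.integrable_of_continuous (by fun_prop))
      (SphereCov.integrable_of_continuous (by fun_prop)) (le_of_eq ?_)
    rw [int_snd (fun x => f x * Real.exp (f x)) (by fun_prop)]
    exact SphereCov.integral_mul_exp_eq hd hf hmean
  refine ⟨first, first.trans ?_⟩
  have hc : 0 ≤ SphereCov.c (d + 1) := measureReal_nonneg
  set k : SphereCov.S (d + 1) → ℝ :=
    fun x => Real.exp (SphereCov.c (d + 1) * ‖SphereCov.sphereGradient f x‖ ^ 2) with hk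
  have hkc : Continuous k := by fun_prop
  calc _ ≤ ∫ p, (2⁻¹ : ℝ) * (k p.1 + k p.2) ∂(SphereCov.mu (d + 1)) := by
        refine integral_mono (SphereCov.integrable_of_continuous (by fun_prop))
          (SphereCov.integrable_of_continuous (by fun_prop)) fun p => ?_
        set a := SphereCov.sphereGradient f p.1 with ha
        set b := SphereCov.sphereGradient f p.2 with hb
        have h1 : SphereCov.c (d + 1) * ⟪a, b⟫ ≤
            SphereCov.c (d + 1) * ‖a‖ ^ 2 / 2 + SphereCov.c (d + 1) * ‖b‖ ^ 2 / 2 := by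
          have h2 : ⟪a, b⟫ ≤ (‖a‖ ^ 2 + ‖b‖ ^ 2) / 2 := by
            nlinarith [real_inner_le_norm a b, sq_nonneg (‖a‖ - ‖b‖)]
          nlinarith [mul_le_mul_of_nonneg_left h2 hc]
        -- Writing `k` as a square turns the arithmetic-geometric mean inequality into nonnegativity
        -- of a squared difference.
        have h3 : ∀ x, k x = Real.exp
            (SphereCov.c (d + 1) * ‖SphereCov.sphereGradient f x‖ ^ 2 / 2) ^ 2 := fun x => by
          rw [← Real.exp_nat_mul]
          simp only [hk]
          congr 1
          push_cast
          ring
        simp only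
        rw [h3, h3, ← ha, ← hb]
        refine (Real.exp_le_exp.2 h1).trans ?_
        rw [Real.exp_add]
        nlinarith [sq_nonneg (Real.exp (SphereCov.c (d + 1) * ‖a‖ ^ 2 / 2) -
          Real.exp (SphereCov.c (d + 1) * ‖b‖ ^ 2 / 2))]
    _ = ∫ x, k x ∂(SphereCov.sigma (d + 1)) := by
        rw [integral_const_mul, integral_add
          (SphereCov.integrable_of_continuous (by fun_prop))
          (SphereCov.integrable_of_continuous (by fun_prop)), int_fst k hkc, int_snd k hkc]
        ring
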